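/- Let $q\ge 2$, $n\ge 1$ and $\Sigma=\{0<1<\cdots<q-1\}$. A Lyndon word is a nonempty word that is lexicographically smaller than each of its nontrivial rotations. Let $\ell_n$ be the number of Lyndon words of length $n$ over $\Sigma$, $L_n=\ell_1+\cdots+\ell_n$ and $\Lambda_n=L_1+\cdots+L_n$. For a word $w$ of length at most $n$ let $D(w)$ be the prefix of length $n$ of $www\cdots$; for $v=ub[q-1]^t$ with $b\ne[q-1]$ let $P(v)=u[b+1]$; and let $N(w)=P(D(w))$ (Duval's successor). A word is stored in compressed form, as an array of cells in which each symbol other than $[q-1]$ has its own cell and each maximal block $[q-1]^i$ is one cell holding the number $i$. An update changes one cell: it appends a cell at the end, removes the last cell, or overwrites the last cell. The algorithm starts from the array of the first Lyndon word of length $n$ ($0^{n-1}1$ if $n\ge2$, and $0$ if $n=1$), replaces the stored word $w$ by $N(w)$ repeatedly, outputs the words of length exactly $n$ that it visits, and stops at the one-letter word $[q-1]$. To pass from $w$ to $N(w)$, it appends the remaining cells of $D(w)$ one by one (a last block that is cut by the length bound $n$ is appended as a shorter block), removes the final number cell if there is one, and increments the last symbol; if that symbol becomes $[q-1]$, then its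 cell is removed and the number cell in front of it is increased by one (two updates) or, if there is no number cell in front of it, its cell is overwritten by the number $1$ (one update). Theorem. (1) For all $q\ge2$ and $n\ge1$ the algorithm stops; after every step $k$ up to the halting time, the array is the compressed representation of the word $N^k(w_0)$, where $w_0$ is the first word; and it outputs every Lyndon word of length $n$ over $\Sigma$ exactly once and nothing else. The total number of updates, including those on shorter intermediate words, divided by the number of words output is at most $$\frac{3(\Lambda_n-L_n)+\ell_n}{\ell_n}.$$ (2) As $n\to\infty$, uniformly in $q\ge2$, $$\frac{3(\Lambda_n-L_n)+\ell_n}{\ell_n}=1+\frac{3q}{(q-1)^2}+o(1).$$ (3) Consequently the algorithm runs in constant amortized time with respect to updates: there is a constant $C$ such that for all $q\ge 2$ and $n\ge1$ the amortized number of updates is at most $C$. -/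

import Mathlib

namespace LyndonEnum

/-! ### Lyndon words over the alphabet `{0, 1, …, q - 1}` -/

/-- A word is Lyndon if it is nonempty and lexicographically smaller than each of its
nontrivial rotations. -/
def IsLyndon (w : List ℕ) : Prop :=
  w ≠ [] ∧ ∀ i : ℕ, 0 < i → i < w.length → w < w.rotate i

/-- The set of Lyndon words of length `n` over the alphabet `{0, …, q - 1}`. -/
def lyndonWords (q n : ℕ) : Set (List ℕ) :=
  {w | w.length = n ∧ (∀ a ∈ w, a < q) ∧ IsLyndon w}

/-- The number `ℓ_n` of Lyndon words of length `n`. -/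
noncomputable def ell (q n : ℕ) : ℕ := (lyndonWords q n).ncard

/-- `L_n = ℓ_1 + ⋯ + ℓ_n`. -/
noncomputable def cumL (q n : ℕ) : ℕ := ∑ i ∈ Finset.Icc 1 n, ell q i

/-- `Λ_n = L_1 + ⋯ + L_n`. -/
noncomputable def cumLambda (q n : ℕ) : ℕ := ∑ i ∈ Finset.Icc 1 n, cumL q i

/-! ### Duval's successor map on words -/

/-- `D(w)`: the prefix of length `n` of `w w w ⋯` (for nonempty `w`). -/
def duvalExtend (n : ℕ) (w : List ℕ) : List ℕ := ((List.replicate n w).flatten).take n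

/-- `P(u b [q-1]^t) = u [b+1]` for `b ≠ q - 1`. -/
def duvalIncr (q : ℕ) (v : List ℕ) : List ℕ :=
  match v.reverse.dropWhile (fun a => decide (a + 1 = q)) with
  | [] => []
  | b :: u => u.reverse ++ [b + 1]

/-- `N(w) = P(D(w))`, the next Lyndon word of length at most `n`. -/
def duvalNext (q n : ℕ) (w : List ℕ) : List ℕ := duvalIncr q (duvalExtend n w)

/-- The first Lyndon word of length `n`: `0` if `n = 1`, and `0 ⋯ 0 1` if `n ≥ 2`. -/
def firstWord (n : ℕ) : List ℕ :=
  if n = 1 then [0] else List.replicate (n - 1) 0 ++ [1]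

/-! ### The compressed representation -/

/-- A cell of the array: a symbol different from `q - 1`, or a number `i` that stands for
the maximal block `[q-1]^i`. -/
inductive Cell where
  | sym (a : ℕ)
  | run (i : ℕ)
  deriving DecidableEq

/-- The compressed representation of a word. -/
def compress (q : ℕ) : List ℕ → List Cell
  | [] => []
  | a :: w =>
    if a + 1 = q then
      match compress q w with
      | Cell.run i :: r => Cell.run (i + 1) :: r
      | r => Cell.run 1 :: r
    else Cell.sym a :: compress q w

/-- The number of letters that a cell stands for. -/
def Cell.len : Cell → ℕ
  | Cell.sym _ => 1
  | Cell.run i => i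

/-- The word that a cell stands for. -/
def Cell.word (q : ℕ) : Cell → List ℕ
  | Cell.sym a => [a]
  | Cell.run i => List.replicate i (q - 1)

/-- The word stored in an array of cells. -/
def decompress (q : ℕ) (r : List Cell) : List ℕ := r.flatMap (Cell.word q)

/-- The length of the word stored in an array of cells. -/
def wordLen (r : List Cell) : ℕ := (r.map Cell.len).sum

/-! ### Updates, and the algorithm as a sequence of updates -/

/-- An elementary update changes one cell: append a cell at the end, remove the last cell,
or overwrite the last cell. -/
inductive Update where
  | push (c : Cell)
  | pop
  | set (c : Cell)

/-- The effect of one update. -/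
def Update.apply (r : List Cell) : Update → List Cell
  | Update.push c => r ++ [c]
  | Update.pop => r.dropLast
  | Update.set c => r.dropLast ++ [c]

/-- The effect of a sequence of updates, performed from left to right. -/
def applyAll (r : List Cell) (us : List Update) : List Cell := us.foldl Update.apply r

/-- The first `k` letters of a stored word, as an array of cells (the last run is cut). -/
def takeCells : ℕ → List Cell → List Cell
  | 0, _ => []
  | _ + 1, [] => []
  | k + 1, Cell.sym a :: r => Cell.sym a :: takeCells k r
  | k + 1, Cell.run i :: r => Cell.run (min i (k + 1)) :: takeCells (k + 1 - i) r

/-- Updates that turn `w` into `D(w)`: append, one at a time, the cells of the periodic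
continuation of `w`, up to total length `n`. -/
def extendUpdates (n : ℕ) (r : List Cell) : List Update :=
  (takeCells (n - wordLen r) (List.replicate n r).flatten).map Update.push

/-- Updates that increment the last symbol `a` of an array that ends in a symbol. If `a + 1`
is `q - 1`, then the cell is merged into the number cell in front of it (remove the symbol,
increase the number) or, if there is none, is overwritten by the number `1`. -/
def incrSymUpdates (q : ℕ) (r : List Cell) : List Update :=
  match r.reverse with
  | Cell.sym a :: s =>
    if a + 2 = q then
      match s with
      | Cell.run i :: _ => [Update.pop, Update.set (Cell.run (i + 1))]
      | _ => [Update.set (Cell.run 1)]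
    else [Update.set (Cell.sym (a + 1))]
  | _ => []

/-- Updates that turn `v` into `P(v)`: remove the final number cell, if there is one, and
then increment the last symbol. -/
def incrUpdates (q : ℕ) (r : List Cell) : List Update :=
  match r.reverse with
  | Cell.run _ :: _ => Update.pop :: incrSymUpdates q r.dropLast
  | _ => incrSymUpdates q r

/-- All updates of one step of the algorithm, from `w` through `D(w)` to `P(D(w))`. -/
def stepUpdates (q n : ℕ) (r : List Cell) : List Update :=
  extendUpdates n r ++ incrUpdates q (applyAll r (extendUpdates n r))

/-- One step of the algorithm. -/
def step (q n : ℕ) (r : List Cell) : List Cell := applyAll r (stepUpdates q n r)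

/-- The array after `k` steps, starting from the first Lyndon word of length `n`. -/
def state (q n k : ℕ) : List Cell := (step q n)^[k] (compress q (firstWord n))

/-- The algorithm stops when it reaches the one-letter word `[q-1]`, which has no successor. -/
def Halted (r : List Cell) : Prop := r = [Cell.run 1]

/-- The number of steps until the algorithm stops. -/
noncomputable def haltTime (q n : ℕ) : ℕ := sInf {k | Halted (state q n k)}

/-- The list of words that the algorithm outputs, in order: the words of length exactly `n`
among those that it visits. -/
noncomputable def output (q n : ℕ) : List (List ℕ) :=
  ((List.range (haltTime q n + 1)).map (fun k => decompress q (state q n k))).filter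
    (fun w => decide (w.length = n))

/-- The number of updates in the whole run (including those on the intermediate, shorter
words). -/
noncomputable def totalUpdates (q n : ℕ) : ℕ :=
  ∑ k ∈ Finset.range (haltTime q n), (stepUpdates q n (state q n k)).length

/-- The amortized number of updates per output word. -/
noncomputable def amortizedUpdates (q n : ℕ) : ℝ :=
  (totalUpdates q n : ℝ) / ((output q n).length : ℝ)

end LyndonEnum

/-! Correctness. If `w` is Lyndon, then `N(w)` is a prefix of `www⋯` with its last letter raised by
one, and such a word is again Lyndon (`IsLyndon.of_periodic`). Conversely, a Lyndon word `v > w`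
first leaves `www⋯` upwards (`IsLyndon.exceeds_periodic`). Since `D(w)` has only letters `q-1`
behind the raised position, `v` cannot leave later than `N(w)` does. Hence `N(w)` is the least
Lyndon word of length at most `n` above `w` (`IsLyndonUpTo.next_le`). The words visited increase in
a finite set, skip nothing and end at `[q-1]`. A well-formed array is determined by its word
(`compress_decompress`), so the updates on cells follow `N` exactly.

Cost. The length of the array is a potential. Appending `p ≤ n - |w|` cells costs `p` and adds `p`
to the length; in the increment, updates plus final length equal the previous length plus one. Thus
in each step updates plus new length are at most `2(n - |w|)` plus old length plus one
(`step_compress`). This telescopes to at most twice the number of missing letters, plus the number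
of steps, plus the initial length. The missing letters of all Lyndon words of length at most `n`
number `S = Λ_n - L_n` (`cumLambda_eq`), there are at most `L_n ≤ S + ℓ_n` steps, and the initial
length is paid for by the unvisited word `0`. The total is at most `3S + ℓ_n`.

Asymptotics. Words without a nontrivial rotational symmetry are exactly the rotations of Lyndon
words, and all other words have a rotation period at most `n/2`; so `n ℓ_n / q^n → 1` uniformly in
`q`. In `S / ℓ_n = ∑ j ℓ_{n-j} / ℓ_n` the `j`-th term is therefore asymptotic to `j q^{-j}`, and it
is at most `2j(j+1)2^{-j}` for all `q` and `n`. Dominated convergence along `lengthFilter`, which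
encodes uniformity in `q`, gives the limit `∑ j q^{-j} = q/(q-1)^2`; the same majorant bounds the
amortized cost. -/

namespace LyndonEnum

/-! ### Lexicographic comparison by positions -/

lemma lt_iff_getD (u v : List ℕ) :
    u < v ↔ ∃ i, i < v.length ∧ i ≤ u.length ∧ (∀ j < i, u.getD j 0 = v.getD j 0) ∧
      (i < u.length → u.getD i 0 < v.getD i 0) := by
  rw [List.lt_iff_exists]
  constructor
  · rintro (⟨h, hl⟩ | ⟨i, h₁, h₂, h, hlt⟩)
    · refine ⟨u.length, hl, le_rfl, fun j hj => ?_, fun h => absurd h (lt_irrefl _)⟩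
      rw [h, List.getD_eq_getElem _ _ (by simpa using ⟨hj, by omega⟩),
        List.getD_eq_getElem _ _ (by omega)]
      simp
    · refine ⟨i, h₂, h₁.le, fun j hj => ?_, fun _ => ?_⟩
      · rw [List.getD_eq_getElem _ _ (by omega), List.getD_eq_getElem _ _ (by omega), h j hj]
      · rw [List.getD_eq_getElem _ _ (by omega), List.getD_eq_getElem _ _ (by omega)]
        exact hlt
  · rintro ⟨i, h₂, h₁, h, hlt⟩
    rcases h₁.lt_or_eq with h₁ | h₁
    · refine Or.inr ⟨i, h₁, h₂, fun j hj => ?_, ?_⟩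
      · have := h j hj
        rwa [List.getD_eq_getElem _ _ (by omega), List.getD_eq_getElem _ _ (by omega)] at this
      · have := hlt h₁
        rwa [List.getD_eq_getElem _ _ (by omega), List.getD_eq_getElem _ _ (by omega)] at this
    · refine Or.inl ⟨List.ext_getElem (by simp; omega) fun j hj hj' => ?_, by omega⟩
      have := h j (by omega)
      rw [List.getD_eq_getElem _ _ (by omega), List.getD_eq_getElem _ _ (by omega)] at this
      simpa using this

lemma ext_getD {u v : List ℕ} (hl : u.length = v.length)
    (h : ∀ i < u.length, u.getD i 0 = v.getD i 0) : u = v := by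
  refine List.ext_getElem hl fun i h₁ h₂ => ?_
  have := h i h₁
  rwa [List.getD_eq_getElem _ _ h₁, List.getD_eq_getElem _ _ h₂] at this

lemma getD_rotate (w : List ℕ) (i k : ℕ) (hk : k < w.length) :
    (w.rotate i).getD k 0 = w.getD ((k + i) % w.length) 0 := by
  rw [List.getD_eq_getElem _ _ (by simpa using hk), List.getElem_rotate,
    List.getD_eq_getElem _ _ (Nat.mod_lt _ (by omega))]

/-! ### Lyndon words and their suffixes -/

/-- A Lyndon word differs from each proper suffix at a first position, where it is smaller. -/
lemma IsLyndon.suffix {w : List ℕ} (hw : IsLyndon w) {i : ℕ} (hi : 0 < i) (him : i < w.length) :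
    ∃ j, i + j < w.length ∧ (∀ t < j, w.getD t 0 = w.getD (i + t) 0) ∧
      w.getD j 0 < w.getD (i + j) 0 := by
  obtain ⟨j, hj, -, ha, hb⟩ := (lt_iff_getD _ _).1 (hw.2 i hi him)
  rw [List.length_rotate] at hj
  replace hb := hb hj
  rw [getD_rotate _ _ _ hj] at hb
  have ha' : ∀ t < j, w.getD t 0 = w.getD ((t + i) % w.length) 0 := fun t ht => by
    rw [ha t ht, getD_rotate _ _ _ (by omega)]
  by_cases hij : i + j < w.length
  · refine ⟨j, hij, fun t ht => ?_, ?_⟩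
    · rw [ha' t ht, Nat.mod_eq_of_lt (by omega), add_comm]
    · rwa [Nat.mod_eq_of_lt (by omega), add_comm] at hb
  -- Otherwise the first difference lies past the wrap, so the suffix from `i` is also a prefix, of
  -- length `d`. The rotation by `i` then says that the suffix from `d` first differs from `w` at
  -- `e`, downwards, whereas the rotation by `d` compares the same letters and demands an upward
  -- difference.
  exfalso
  obtain ⟨d, hd⟩ : ∃ d, d + i = w.length := ⟨w.length - i, by omega⟩
  obtain ⟨e, rfl⟩ : ∃ e, j = d + e := ⟨j - d, by omega⟩
  have hmod : ∀ t, d + t < w.length → (d + t + i) % w.length = t := fun t ht => by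
    rw [show d + t + i = t + w.length by omega, Nat.add_mod_right, Nat.mod_eq_of_lt (by omega)]
  rw [hmod e hj] at hb
  obtain ⟨k, hk, -, hc, hc'⟩ := (lt_iff_getD _ _).1 (hw.2 d (by omega) (by omega))
  rw [List.length_rotate] at hk
  replace hc' := hc' hk
  rw [getD_rotate _ _ _ hk] at hc'
  have hc2 : ∀ t < k, d + t < w.length → w.getD t 0 = w.getD (d + t) 0 := fun t ht htl => by
    rw [hc t ht, getD_rotate _ _ _ (by omega), Nat.mod_eq_of_lt (by omega), add_comm]
  rcases lt_trichotomy e k with h | h | h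
  · have := hc2 e h hj
    omega
  · subst h
    rw [add_comm e d, Nat.mod_eq_of_lt hj] at hc'
    omega
  · rw [add_comm k d, Nat.mod_eq_of_lt (by omega)] at hc'
    have := ha' (d + k) (by omega)
    rw [hmod k (by omega)] at this
    omega

/-- The deciding position comes before the rotation wraps around, so suffix and rotation compare
alike. -/
lemma isLyndon_of_suffix {w : List ℕ} (hw : w ≠ [])
    (h : ∀ i, 0 < i → i < w.length → ∃ j, i + j < w.length ∧
      (∀ t < j, w.getD t 0 = w.getD (i + t) 0) ∧ w.getD j 0 < w.getD (i + j) 0) :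
    IsLyndon w := by
  refine ⟨hw, fun i hi him => (lt_iff_getD _ _).2 ?_⟩
  obtain ⟨j, hj, ha, hb⟩ := h i hi him
  refine ⟨j, by simp; omega, by omega, fun t ht => ?_, fun _ => ?_⟩
  · rw [getD_rotate _ _ _ (by omega), Nat.mod_eq_of_lt (by omega), ha t ht, add_comm]
  · rwa [getD_rotate _ _ _ (by omega), Nat.mod_eq_of_lt (by omega), add_comm j]

/-! ### The periodic continuation of a Lyndon word -/

/-- The letter at position `i` of `w w w ⋯`. -/
def periodic (w : List ℕ) (i : ℕ) : ℕ := w.getD (i % w.length) 0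

lemma periodic_of_lt {w : List ℕ} {i : ℕ} (h : i < w.length) : periodic w i = w.getD i 0 := by
  rw [periodic, Nat.mod_eq_of_lt h]

lemma periodic_add_length (w : List ℕ) (i : ℕ) : periodic w (w.length + i) = periodic w i := by
  rw [periodic, periodic, Nat.add_mod_left]

/-- Replacing the last letter of a prefix of `w w w ⋯` by a larger one gives a Lyndon word. -/
lemma IsLyndon.of_periodic {w v : List ℕ} (hw : IsLyndon w) {k : ℕ} (hl : v.length = k + 1)
    (hv : ∀ j < k, v.getD j 0 = periodic w j) (hk : periodic w k < v.getD k 0) : IsLyndon v := by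
  have hm : 0 < w.length := List.length_pos_iff.2 hw.1
  refine isLyndon_of_suffix (by rintro rfl; simp at hl) fun i hi him => ?_
  -- A suffix that starts at a multiple of the period copies `v` until the raised last letter
  -- decides; any other suffix starts inside a copy of `w`, where the Lyndon property of `w`
  -- applies.
  rcases Nat.eq_zero_or_pos (i % w.length) with h0 | h0
  · have hp : ∀ t, periodic w (i + t) = periodic w t := fun t => by
      rw [periodic, periodic, Nat.add_mod, h0, zero_add, Nat.mod_mod]
    refine ⟨k - i, by omega, fun t ht => ?_, ?_⟩
    · rw [hv _ (by omega), hv _ (by omega), hp]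
    · rw [hv _ (by omega), ← hp, show i + (k - i) = k by omega]
      exact hk
  · obtain ⟨j, hj, ha, hb⟩ := hw.suffix h0 (Nat.mod_lt _ hm)
    have hp : ∀ t, i % w.length + t < w.length →
        periodic w (i + t) = w.getD (i % w.length + t) 0 := fun t ht => by
      rw [periodic, Nat.add_mod, Nat.mod_eq_of_lt (b := w.length) (a := t) (by omega),
        Nat.mod_eq_of_lt ht]
    rcases lt_or_ge j (k - i) with h | h
    · refine ⟨j, by omega, fun t ht => ?_, ?_⟩
      · rw [hv _ (by omega), hv _ (by omega), hp _ (by omega), ← ha t ht,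
          periodic_of_lt (by omega)]
      · rw [hv _ (by omega), hv _ (by omega), hp _ (by omega), periodic_of_lt (by omega)]
        exact hb
    -- The difference inside `w` is not reached before the last letter of `v`, so up to there the
    -- comparison is at worst an equality, and the raised letter makes it strict.
    · refine ⟨k - i, by omega, fun t ht => ?_, ?_⟩
      · rw [hv _ (by omega), hv _ (by omega), hp _ (by omega), ← ha t (by omega),
          periodic_of_lt (by omega)]
      · rw [hv _ (by omega), show i + (k - i) = k by omega, periodic_of_lt (by omega)]
        refine lt_of_le_of_lt ?_ hk
        have := hp (k - i) (by omega)
        rw [show i + (k - i) = k by omega] at this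
        rw [this]
        rcases h.lt_or_eq with h | h
        · exact (ha _ h).le
        · exact h ▸ hb.le

/-- A Lyndon word `v` greater than the Lyndon word `w` exceeds `w w w ⋯` at the first position
where they differ, and such a position exists. -/
lemma IsLyndon.exceeds_periodic {w v : List ℕ} (hw : w ≠ []) (hv : IsLyndon v) (h : w < v) :
    ∃ i < v.length, (∀ j < i, v.getD j 0 = periodic w j) ∧ periodic w i < v.getD i 0 := by
  have hm : 0 < w.length := List.length_pos_iff.2 hw
  obtain ⟨i, hiv, hiw, ha, hb⟩ := (lt_iff_getD _ _).1 h
  rcases hiw.lt_or_eq with hiw | rfl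
  · refine ⟨i, hiv, fun j hj => ?_, ?_⟩
    · rw [periodic_of_lt (by omega), ha j hj]
    · rw [periodic_of_lt (by omega)]
      exact hb hiw
  -- Now `w` is a proper prefix of `v`. Were `v` to fall below `www⋯` at its first deviation `|w| +
  -- e`, the suffix of `v` behind `w` would first differ from `v` at `e`, downwards, contrary to
  -- `hv`.
  obtain ⟨j, hj, hc, hd⟩ := hv.suffix hm hiv
  have hne : ∃ i, i < v.length ∧ v.getD i 0 ≠ periodic w i := by
    by_contra! hall
    rw [hall _ hj, hall _ (by omega), periodic_add_length] at hd
    exact lt_irrefl _ hd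
  classical
  obtain ⟨hil, hine⟩ := Nat.find_spec hne
  have hmin : ∀ t < Nat.find hne, v.getD t 0 = periodic w t := fun t ht => by
    by_contra hcon
    exact Nat.find_min hne ht ⟨by omega, hcon⟩
  generalize Nat.find hne = i at *
  refine ⟨i, hil, hmin, ?_⟩
  by_contra hcon
  have hlt : v.getD i 0 < periodic w i := by omega
  have hwi : w.length ≤ i := by
    by_contra hcon
    rw [periodic_of_lt (by omega), ha _ (by omega)] at hlt
    omega
  obtain ⟨e, rfl⟩ := Nat.exists_eq_add_of_le hwi
  rw [periodic_add_length] at hlt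
  rcases lt_trichotomy j e with h | h | h
  · rw [hmin _ (by omega), hmin _ (by omega), periodic_add_length] at hd
    omega
  · subst h
    rw [hmin j (by omega)] at hd
    omega
  · have := hc e h
    rw [hmin e (by omega)] at this
    omega

/-! ### Duval's successor -/

lemma length_flatten_replicate {α : Type*} (n : ℕ) (w : List α) :
    (List.replicate n w).flatten.length = n * w.length := by
  simp

lemma getD_flatten_replicate (n : ℕ) (w : List ℕ) (i : ℕ) (hi : i < n * w.length) :
    (List.replicate n w).flatten.getD i 0 = periodic w i := by
  induction n generalizing i with
  | zero => simp at hi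
  | succ n ih =>
    rw [List.replicate_succ, List.flatten_cons]
    rcases lt_or_ge i w.length with h | h
    · rw [List.getD_append _ _ _ _ h, periodic_of_lt h]
    · obtain ⟨e, rfl⟩ := Nat.exists_eq_add_of_le h
      rw [List.getD_append_right _ _ _ _ h, periodic_add_length, Nat.add_sub_cancel_left]
      exact ih e (by rw [add_mul] at hi; omega)

lemma length_duvalExtend {n : ℕ} {w : List ℕ} (hw : w ≠ []) : (duvalExtend n w).length = n := by
  have hm : 0 < w.length := List.length_pos_iff.2 hw
  rw [duvalExtend, List.length_take, length_flatten_replicate]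
  exact min_eq_left (Nat.le_mul_of_pos_right n hm)

lemma getD_take {w : List ℕ} {n i : ℕ} (h : i < n) : (w.take n).getD i 0 = w.getD i 0 := by
  simp [List.getD_eq_getElem?_getD, h]

lemma getD_duvalExtend {n i : ℕ} {w : List ℕ} (hw : w ≠ []) (hi : i < n) :
    (duvalExtend n w).getD i 0 = periodic w i := by
  have hm : 0 < w.length := List.length_pos_iff.2 hw
  rw [duvalExtend, getD_take hi, getD_flatten_replicate]
  exact lt_of_lt_of_le hi (Nat.le_mul_of_pos_right n hm)

lemma duvalIncr_append {q b : ℕ} (hb : b + 1 < q) (u : List ℕ) (t : ℕ) :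
    duvalIncr q (u ++ b :: List.replicate t (q - 1)) = u ++ [b + 1] := by
  have h : ∀ s : List ℕ, List.dropWhile (fun a => decide (a + 1 = q))
      (List.replicate t (q - 1) ++ s) = List.dropWhile (fun a => decide (a + 1 = q)) s := by
    intro s
    induction t with
    | zero => rfl
    | succ t ih =>
      rw [List.replicate_succ, List.cons_append, List.dropWhile_cons_of_pos (by simp; omega), ih]
  have : (u ++ b :: List.replicate t (q - 1)).reverse.dropWhile (fun a => decide (a + 1 = q))
      = b :: u.reverse := by
    rw [List.reverse_append, List.reverse_cons, List.reverse_replicate, List.append_assoc, h,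
      List.singleton_append, List.dropWhile_cons_of_neg (by simpa using hb.ne)]
  unfold duvalIncr
  rw [this]
  simp

/-- A word that does not consist of letters `q - 1` only is of the form `u b [q-1]^t`. -/
lemma exists_eq_append_replicate {q : ℕ} (v : List ℕ) (h : ∃ a ∈ v, a + 1 ≠ q) :
    ∃ u b t, b + 1 ≠ q ∧ v = u ++ b :: List.replicate t (q - 1) := by
  induction v using List.reverseRecOn with
  | nil => simp at h
  | append_singleton v a ih =>
    by_cases ha : a + 1 = q
    · obtain ⟨c, hc, hcq⟩ := h
      have hcv : c ∈ v := by
        rcases List.mem_append.1 hc with h | h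
        · exact h
        · simp at h; omega
      obtain ⟨u, b, t, hb, rfl⟩ := ih ⟨c, hcv, hcq⟩
      refine ⟨u, b, t + 1, hb, ?_⟩
      rw [List.replicate_succ']
      simp; omega
    · exact ⟨v, a, 0, ha, rfl⟩

/-- The Lyndon words of length at most `n` over `{0, …, q - 1}`. -/
def IsLyndonUpTo (q n : ℕ) (w : List ℕ) : Prop :=
  IsLyndon w ∧ w.length ≤ n ∧ ∀ a ∈ w, a < q

lemma getD_lt {q : ℕ} {w : List ℕ} (h : ∀ a ∈ w, a < q) {i : ℕ} (hi : i < w.length) :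
    w.getD i 0 < q := by
  rw [List.getD_eq_getElem _ _ hi]
  exact h _ (List.getElem_mem hi)

/-- In a longer word the last letter, as a proper suffix, would have to exceed the first, which is
already maximal. Hence every Lyndon word other than `[q-1]` has a letter that can be incremented,
and its array starts with a symbol. -/
lemma IsLyndon.eq_singleton {q : ℕ} {w : List ℕ} (hw : IsLyndon w) (hq : ∀ a ∈ w, a < q)
    (h0 : w.getD 0 0 + 1 = q) : w = [q - 1] := by
  have hm : 0 < w.length := List.length_pos_iff.2 hw.1
  have : w.length = 1 := by
    by_contra hne
    obtain ⟨j, hj, -, hlt⟩ := hw.suffix (i := w.length - 1) (by omega) (by omega)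
    obtain rfl : j = 0 := by omega
    have := getD_lt hq hj
    omega
  obtain ⟨a, rfl⟩ := List.length_eq_one_iff.1 this
  simp at h0
  simp; omega

/-- The data of one step: `D(w) = u b [q-1]^t` with `b < q - 1`, and `N(w) = u [b+1]`. -/
lemma IsLyndonUpTo.exists_decomp {q n : ℕ} {w : List ℕ} (hw : IsLyndonUpTo q n w)
    (hne : w ≠ [q - 1]) :
    ∃ u b t, b + 1 < q ∧ duvalExtend n w = u ++ b :: List.replicate t (q - 1) ∧
      duvalNext q n w = u ++ [b + 1] := by
  have hm : 0 < w.length := List.length_pos_iff.2 hw.1.1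
  have hDl := length_duvalExtend (n := n) hw.1.1
  have h0 : w.getD 0 0 + 1 ≠ q := fun h => hne (hw.1.eq_singleton hw.2.2 h)
  have hn : 0 < n := by have := hw.2.1; omega
  have hD0 : (duvalExtend n w).getD 0 0 = w.getD 0 0 := by
    rw [getD_duvalExtend hw.1.1 hn, periodic_of_lt hm]
  obtain ⟨u, b, t, hb, h⟩ := exists_eq_append_replicate (q := q) (duvalExtend n w)
    ⟨_, List.getElem_mem (by omega : 0 < (duvalExtend n w).length), by
      rw [← List.getD_eq_getElem _ 0, hD0]; exact h0⟩
  have hbq : b < q := by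
    have hmem : b ∈ duvalExtend n w := by rw [h]; simp
    have hmem2 := List.mem_of_mem_take hmem
    obtain ⟨l, hl, hbl⟩ := List.mem_flatten.1 hmem2
    rw [List.eq_of_mem_replicate hl] at hbl
    exact hw.2.2 b hbl
  have hb' : b + 1 < q := by omega
  exact ⟨u, b, t, hb', h, by rw [duvalNext, h, duvalIncr_append hb']⟩

/-- Positionwise description of Duval's successor. -/
lemma IsLyndonUpTo.exists_next {q n : ℕ} {w : List ℕ} (hw : IsLyndonUpTo q n w)
    (hne : w ≠ [q - 1]) :
    ∃ k < n, (duvalNext q n w).length = k + 1 ∧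
      (∀ j < k, (duvalNext q n w).getD j 0 = periodic w j) ∧
      (duvalNext q n w).getD k 0 = periodic w k + 1 ∧ periodic w k + 1 < q ∧
      ∀ j, k < j → j < n → periodic w j = q - 1 := by
  obtain ⟨u, b, t, hb, hD, hN⟩ := hw.exists_decomp hne
  have hDl := length_duvalExtend (n := n) hw.1.1
  rw [hD] at hDl
  simp at hDl
  have hg : ∀ j < n, periodic w j = (u ++ b :: List.replicate t (q - 1)).getD j 0 :=
    fun j hj => by rw [← hD, getD_duvalExtend hw.1.1 hj]
  have hk : periodic w u.length = b := by
    rw [hg _ (by omega), List.getD_append_right _ _ _ _ le_rfl]; simp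
  rw [hN]
  refine ⟨u.length, by omega, by simp, fun j hj => ?_, ?_, by omega, fun j hj hjn => ?_⟩
  · rw [hg _ (by omega), List.getD_append _ _ _ _ hj, List.getD_append _ _ _ _ hj]
  · rw [List.getD_append_right _ _ _ _ le_rfl, hk]; simp
  · obtain ⟨e, rfl⟩ := Nat.exists_eq_add_of_le (Nat.succ_le_of_lt hj)
    rw [hg _ hjn, List.getD_append_right _ _ _ _ (by omega),
      show u.length.succ + e - u.length = e + 1 by omega, List.getD_cons_succ,
      List.getD_eq_getElem _ _ (by simp; omega)]
    simp

lemma periodic_lt {q : ℕ} {w : List ℕ} (hw : w ≠ []) (h : ∀ a ∈ w, a < q) (i : ℕ) :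
    periodic w i < q :=
  getD_lt h (Nat.mod_lt _ (List.length_pos_iff.2 hw))

lemma forall_mem_of_getD {P : ℕ → Prop} {w : List ℕ} (h : ∀ i < w.length, P (w.getD i 0)) :
    ∀ a ∈ w, P a := by
  intro a ha
  obtain ⟨i, hi, rfl⟩ := List.getElem_of_mem ha
  rw [← List.getD_eq_getElem _ 0]
  exact h i hi

lemma IsLyndonUpTo.next {q n : ℕ} {w : List ℕ} (hw : IsLyndonUpTo q n w) (hne : w ≠ [q - 1]) :
    IsLyndonUpTo q n (duvalNext q n w) := by
  obtain ⟨k, hkn, hl, ha, hb, hbq, -⟩ := hw.exists_next hne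
  refine ⟨hw.1.of_periodic hl ha (by omega), by omega, forall_mem_of_getD fun i hi => ?_⟩
  rcases lt_or_ge i k with h | h
  · rw [ha i h]
    exact periodic_lt hw.1.1 hw.2.2 i
  · obtain rfl : i = k := by omega
    omega

lemma IsLyndonUpTo.lt_next {q n : ℕ} {w : List ℕ} (hw : IsLyndonUpTo q n w) (hne : w ≠ [q - 1]) :
    w < duvalNext q n w := by
  obtain ⟨k, hkn, hl, ha, hb, hbq, -⟩ := hw.exists_next hne
  rw [lt_iff_getD]
  rcases lt_or_ge k w.length with h | h
  · refine ⟨k, by omega, h.le, fun j hj => ?_, fun _ => ?_⟩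
    · rw [ha j hj, periodic_of_lt (by omega)]
    · rw [hb, periodic_of_lt h]; omega
  · refine ⟨w.length, by omega, le_rfl, fun j hj => ?_, fun h => absurd h (lt_irrefl _)⟩
    rw [ha j (by omega), periodic_of_lt (by omega)]

/-- The word `v` leaves `www⋯` upwards at some `i`, and `i ≤ k` because no letter exceeds the `q-1`
found behind `k`. If `i < k`, then `v` is larger at `i`; if `i = k`, its letter there is at least
the minimally raised one, so `N(w)` is smaller at `k` or a prefix of `v`. -/
lemma IsLyndonUpTo.next_le {q n : ℕ} {w v : List ℕ} (hw : IsLyndonUpTo q n w)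
    (hne : w ≠ [q - 1]) (hv : IsLyndonUpTo q n v) (h : w < v) : duvalNext q n w ≤ v := by
  obtain ⟨k, hkn, hl, ha, hb, hbq, hc⟩ := hw.exists_next hne
  obtain ⟨i, hi, hd, he⟩ := hv.1.exceeds_periodic hw.1.1 h
  have hvl := hv.2.1
  have hvi := getD_lt hv.2.2 hi
  have hik : i ≤ k := by
    by_contra hcon
    have := hc i (by omega) (by omega)
    omega
  rcases eq_or_ne (duvalNext q n w) v with h | hne
  · exact h.le
  refine le_of_lt ((lt_iff_getD _ _).2 ?_)
  rcases hik.lt_or_eq with hik | rfl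
  · refine ⟨i, hi, by omega, fun j hj => ?_, fun _ => ?_⟩
    · rw [ha j (by omega), hd j hj]
    · rwa [ha i hik]
  · rcases lt_or_ge (periodic w i + 1) (v.getD i 0) with h1 | h1
    · refine ⟨i, hi, by omega, fun j hj => ?_, fun _ => ?_⟩
      · rw [ha j (by omega), hd j hj]
      · rwa [hb]
    · have heq : ∀ j < i + 1, (duvalNext q n w).getD j 0 = v.getD j 0 := fun j hj => by
        rcases (Nat.lt_succ_iff.1 hj).lt_or_eq with hj | rfl
        · rw [ha j hj, hd j hj]
        · omega
      refine ⟨i + 1, ?_, by omega, heq, fun h => by omega⟩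
      by_contra hcon
      exact hne (ext_getD (by omega) fun j hj => heq j (by omega))

/-! ### Well-formed arrays of cells -/

/-- The cell is a number cell. -/
def Cell.IsRun : Cell → Prop
  | Cell.sym _ => False
  | Cell.run _ => True

/-- The cell holds a symbol less than `q - 1` or a positive number. -/
def Cell.Good (q : ℕ) : Cell → Prop
  | Cell.sym a => a + 1 < q
  | Cell.run i => 0 < i

/-- An array is well formed if its cells are good and no two adjacent cells are numbers. -/
def WellFormed (q : ℕ) (r : List Cell) : Prop :=
  (∀ c ∈ r, c.Good q) ∧ r.IsChain fun c d => c.IsRun → ¬ d.IsRun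

lemma wellFormed_append {q : ℕ} {r s : List Cell} :
    WellFormed q (r ++ s) ↔ WellFormed q r ∧ WellFormed q s ∧
      ∀ x ∈ r.getLast?, ∀ y ∈ s.head?, x.IsRun → ¬ y.IsRun := by
  simp only [WellFormed, List.isChain_append, List.mem_append, or_imp, forall_and]
  tauto

lemma wellFormed_cons {q : ℕ} {c : Cell} {s : List Cell} :
    WellFormed q (c :: s) ↔ c.Good q ∧ WellFormed q s ∧
      ∀ y ∈ s.head?, c.IsRun → ¬ y.IsRun := by
  simp only [WellFormed, List.isChain_cons, List.forall_mem_cons]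
  tauto

lemma wellFormed_nil (q : ℕ) : WellFormed q [] := by simp [WellFormed]

lemma wellFormed_singleton {q : ℕ} {c : Cell} (h : c.Good q) : WellFormed q [c] :=
  wellFormed_cons.2 ⟨h, wellFormed_nil q, by simp⟩

/-! ### Arrays of cells as encodings of words -/

lemma decompress_append (q : ℕ) (r s : List Cell) :
    decompress q (r ++ s) = decompress q r ++ decompress q s :=
  List.flatMap_append

lemma decompress_cons (q : ℕ) (c : Cell) (s : List Cell) :
    decompress q (c :: s) = c.word q ++ decompress q s :=
  List.flatMap_cons

lemma decompress_nil (q : ℕ) : decompress q [] = [] := rfl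

lemma decompress_compress (q : ℕ) (w : List ℕ) : decompress q (compress q w) = w := by
  induction w with
  | nil => rfl
  | cons a w ih =>
    rw [compress]
    split_ifs with h
    · obtain rfl : a = q - 1 := by omega
      split
      · rename_i i r heq
        rw [heq, decompress_cons] at ih
        rw [decompress_cons, Cell.word, List.replicate_succ, List.cons_append, ← ih]
        rfl
      · rw [decompress_cons, ih]
        rfl
    · rw [decompress_cons, ih]
      rfl

lemma wellFormed_compress {q : ℕ} {w : List ℕ} (hw : ∀ a ∈ w, a < q) :
    WellFormed q (compress q w) := by
  induction w with
  | nil => exact wellFormed_nil q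
  | cons a w ih =>
    rw [List.forall_mem_cons] at hw
    specialize ih hw.2
    rw [compress]
    split_ifs with h
    · split
      · rename_i i r heq
        rw [heq, wellFormed_cons] at ih
        exact wellFormed_cons.2 ⟨Nat.succ_pos i, ih.2⟩
      · rename_i hne
        refine wellFormed_cons.2 ⟨Nat.one_pos, ih, fun y hy _ => ?_⟩
        cases y with
        | sym a => exact id
        | run i =>
          obtain ⟨r, hr⟩ := List.head?_eq_some_iff.1 hy
          exact absurd hr (hne i r)
    · have := hw.1
      exact wellFormed_cons.2 ⟨show a + 1 < q by omega, ih, fun y _ hy => absurd hy id⟩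

/-- Well-formedness forces the number cells to be exactly the maximal blocks. Equality of
well-formed arrays can thus be checked on the words. -/
lemma compress_decompress {q : ℕ} (hq : 0 < q) {r : List Cell} (hr : WellFormed q r) :
    compress q (decompress q r) = r := by
  induction r with
  | nil => rfl
  | cons c r ih =>
    rw [wellFormed_cons] at hr
    specialize ih hr.2.1
    rw [decompress_cons]
    cases c with
    | sym a =>
      have : a + 1 ≠ q := Nat.ne_of_lt hr.1
      rw [Cell.word, List.singleton_append, compress, if_neg this, ih]
    | run i =>
      have hi : 0 < i := hr.1
      obtain ⟨j, rfl⟩ : ∃ j, i = j + 1 := ⟨i - 1, by omega⟩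
      clear hi
      rw [Cell.word]
      induction j with
      | zero =>
        rw [zero_add, List.replicate_one, List.singleton_append, compress, if_pos (by omega), ih]
        split
        · exact absurd trivial (hr.2.2 _ rfl trivial)
        · rfl
      | succ j ihj =>
        rw [List.replicate_succ, List.cons_append, compress, if_pos (by omega),
          ihj ⟨Nat.succ_pos j, hr.2.1, hr.2.2⟩]

lemma length_word (q : ℕ) (c : Cell) : (c.word q).length = c.len := by
  cases c <;> simp [Cell.word, Cell.len]

lemma length_decompress (q : ℕ) (r : List Cell) : (decompress q r).length = wordLen r := by
  simp [decompress, wordLen, List.length_flatMap, length_word]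

lemma length_le_wordLen {q : ℕ} {r : List Cell} (hr : ∀ c ∈ r, c.Good q) :
    r.length ≤ wordLen r := by
  induction r with
  | nil => simp
  | cons c r ih =>
    rw [List.forall_mem_cons] at hr
    have h1 := ih hr.2
    have h2 : 1 ≤ c.len := by
      cases c with
      | sym a => exact le_rfl
      | run i => exact hr.1
    simp only [wordLen, List.map_cons, List.sum_cons, List.length_cons] at h1 ⊢
    omega

/-! ### Cutting and repeating arrays -/

lemma decompress_takeCells (q k : ℕ) (r : List Cell) :
    decompress q (takeCells k r) = (decompress q r).take k := by
  induction k, r using takeCells.induct with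
  | case1 r => simp [takeCells, decompress_nil]
  | case2 k => simp [takeCells, decompress_nil]
  | case3 k a r ih => simp [takeCells, decompress_cons, Cell.word, ih]
  | case4 k i r ih =>
    simp [takeCells, decompress_cons, Cell.word, ih, List.take_append, min_comm]

lemma head?_takeCells {k : ℕ} {r : List Cell} {y : Cell} (hy : y ∈ (takeCells k r).head?) :
    ∃ z ∈ r.head?, y.IsRun → z.IsRun := by
  cases k with
  | zero => simp [takeCells] at hy
  | succ k =>
    cases r with
    | nil => simp [takeCells] at hy
    | cons c r =>
      cases c with
      | sym a =>
        simp [takeCells] at hy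
        exact ⟨_, rfl, by subst hy; exact id⟩
      | run i => exact ⟨_, rfl, fun _ => trivial⟩

lemma WellFormed.takeCells {q : ℕ} {r : List Cell} (hr : WellFormed q r) (k : ℕ) :
    WellFormed q (takeCells k r) := by
  induction k, r using takeCells.induct with
  | case1 r => simpa [LyndonEnum.takeCells] using wellFormed_nil q
  | case2 k => simpa [LyndonEnum.takeCells] using wellFormed_nil q
  | case3 k a r ih =>
    rw [LyndonEnum.takeCells]
    rw [wellFormed_cons] at hr ⊢
    exact ⟨hr.1, ih hr.2.1, fun y _ h => absurd h id⟩
  | case4 k i r ih =>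
    rw [LyndonEnum.takeCells]
    rw [wellFormed_cons] at hr ⊢
    refine ⟨lt_min hr.1 (Nat.succ_pos k), ih hr.2.1, fun y hy _ hrun => ?_⟩
    obtain ⟨z, hz, hzr⟩ := head?_takeCells hy
    exact hr.2.2 z hz trivial (hzr hrun)

lemma head?_flatten_replicate {α : Type*} {n : ℕ} {r : List α} {y : α}
    (hy : y ∈ (List.replicate n r).flatten.head?) : y ∈ r.head? := by
  cases n with
  | zero => simp at hy
  | succ n =>
    cases r with
    | nil => simp at hy
    | cons c r => simpa [List.replicate_succ] using hy

/-- A copy may end in a number cell; since the next one starts with a symbol, no two numbers meet at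
the junction. -/
lemma WellFormed.flatten_replicate {q : ℕ} {r : List Cell} (hr : WellFormed q r)
    (h : ∀ y ∈ r.head?, ¬ y.IsRun) (n : ℕ) : WellFormed q (List.replicate n r).flatten := by
  induction n with
  | zero => exact wellFormed_nil q
  | succ n ih =>
    rw [List.replicate_succ, List.flatten_cons, wellFormed_append]
    exact ⟨hr, ih, fun x _ y hy _ => h y (head?_flatten_replicate hy)⟩

lemma decompress_flatten_replicate (q n : ℕ) (r : List Cell) :
    decompress q (List.replicate n r).flatten = (List.replicate n (decompress q r)).flatten := by
  induction n with
  | zero => rfl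
  | succ n ih =>
    rw [List.replicate_succ, List.flatten_cons, decompress_append, ih, List.replicate_succ,
      List.flatten_cons]

/-! ### One step of the algorithm -/

lemma applyAll_append (r : List Cell) (us vs : List Update) :
    applyAll r (us ++ vs) = applyAll (applyAll r us) vs :=
  List.foldl_append

lemma applyAll_map_push (r s : List Cell) : applyAll r (s.map Update.push) = r ++ s := by
  induction s generalizing r with
  | nil => simp [applyAll]
  | cons c s ih =>
    have := ih (r ++ [c])
    simpa [applyAll, Update.apply] using this

/-- This is the form in which `extendUpdates` builds `D(w)`: the stored word stays, and only the
continuation is appended. -/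
lemma duvalExtend_eq_append {n : ℕ} {w : List ℕ} (hw : w ≠ []) (hn : w.length ≤ n) :
    duvalExtend n w = w ++ ((List.replicate n w).flatten).take (n - w.length) := by
  have hm : 0 < w.length := List.length_pos_iff.2 hw
  have hnm : n ≤ n * w.length := Nat.le_mul_of_pos_right n hm
  have hl := length_duvalExtend (n := n) hw
  refine ext_getD ?_ fun i hi => ?_
  · rw [hl, List.length_append, List.length_take, length_flatten_replicate]
    omega
  · rw [hl] at hi
    rw [getD_duvalExtend hw hi]
    rcases lt_or_ge i w.length with h | h
    · rw [List.getD_append _ _ _ _ h, periodic_of_lt h]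
    · obtain ⟨e, rfl⟩ := Nat.exists_eq_add_of_le h
      rw [List.getD_append_right _ _ _ _ h, Nat.add_sub_cancel_left, getD_take (by omega),
        getD_flatten_replicate _ _ _ (by omega), periodic_add_length]

/-- The array after the first phase of a step. -/
lemma applyAll_extendUpdates (n : ℕ) (r : List Cell) :
    applyAll r (extendUpdates n r) =
      r ++ takeCells (n - wordLen r) (List.replicate n r).flatten :=
  applyAll_map_push _ _

/-- The last conjunct carries the amortization: overwriting is one update at constant length, while
merging is two updates and shortens the array by one. -/
lemma WellFormed.incrSymUpdates {q b : ℕ} {r : List Cell} (hr : WellFormed q r) (hb : b + 1 < q) :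
    WellFormed q (applyAll (r ++ [Cell.sym b]) (incrSymUpdates q (r ++ [Cell.sym b]))) ∧
    decompress q (applyAll (r ++ [Cell.sym b]) (incrSymUpdates q (r ++ [Cell.sym b]))) =
      decompress q r ++ [b + 1] ∧
    (LyndonEnum.incrSymUpdates q (r ++ [Cell.sym b])).length +
      (applyAll (r ++ [Cell.sym b]) (LyndonEnum.incrSymUpdates q (r ++ [Cell.sym b]))).length =
      r.length + 2 := by
  simp only [LyndonEnum.incrSymUpdates, List.reverse_append, List.reverse_singleton,
    List.singleton_append]
  split_ifs with h
  · split
    · rename_i i s heq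
      obtain ⟨s, rfl⟩ : ∃ s', r = s' ++ [Cell.run i] :=
        ⟨s.reverse, by rw [← List.reverse_reverse r, heq, List.reverse_cons]⟩
      have hq : b + 1 = q - 1 := by omega
      simp only [applyAll, List.foldl_cons, List.foldl_nil, Update.apply, List.dropLast_concat,
        decompress_append, decompress_cons, decompress_nil, Cell.word, hq]
      refine ⟨?_, by simp [List.replicate_succ'], by simp; omega⟩
      rw [wellFormed_append] at hr ⊢
      refine ⟨hr.1, wellFormed_singleton (Nat.succ_pos i), fun x hx y hy hxr _ => ?_⟩
      exact hr.2.2 x hx _ rfl hxr trivial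
    · rename_i hne
      simp only [applyAll, List.foldl_cons, List.foldl_nil, Update.apply, List.dropLast_concat,
        decompress_append, decompress_cons, decompress_nil, Cell.word]
      refine ⟨?_, by simp; omega, by simp; omega⟩
      refine wellFormed_append.2 ⟨hr, wellFormed_singleton Nat.one_pos, fun x hx y _ hxr => ?_⟩
      cases x with
      | sym a => exact absurd hxr id
      | run i =>
        obtain ⟨s, rfl⟩ := List.getLast?_eq_some_iff.1 hx
        exact absurd (by simp) (hne i s.reverse)
  · simp only [applyAll, List.foldl_cons, List.foldl_nil, Update.apply, List.dropLast_concat,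
      decompress_append, decompress_cons, decompress_nil, Cell.word]
    refine ⟨wellFormed_append.2 ⟨hr, wellFormed_singleton ?_, fun x _ y hy _ => ?_⟩, by simp,
      by simp; omega⟩
    · change b + 1 + 1 < q
      omega
    · simp at hy
      subst hy
      exact id

/-- By uniqueness of the encoding, `r` consists of the cells of `u`, the symbol `b` and, if `t > 0`,
one number cell. Removing that cell is one update and shortens the array by one, so the balance of
`incrSymUpdates` persists. -/
lemma WellFormed.incrUpdates {q b t : ℕ} {u : List ℕ} {r : List Cell} (hr : WellFormed q r)
    (hb : b + 1 < q) (h : decompress q r = u ++ b :: List.replicate t (q - 1)) :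
    WellFormed q (applyAll r (incrUpdates q r)) ∧
    decompress q (applyAll r (LyndonEnum.incrUpdates q r)) = u ++ [b + 1] ∧
    (LyndonEnum.incrUpdates q r).length + (applyAll r (LyndonEnum.incrUpdates q r)).length =
      r.length + 1 := by
  have hu : WellFormed q (compress q u) := by
    refine wellFormed_compress fun a ha => ?_
    have hmem : a ∈ decompress q r := by rw [h]; simp [ha]
    obtain ⟨c, hc, hac⟩ := List.mem_flatMap.1 hmem
    have hg := hr.1 c hc
    cases c with
    | sym e =>
      obtain rfl : a = e := by simpa [Cell.word] using hac
      exact lt_trans (Nat.lt_succ_self a) hg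
    | run i =>
      have := List.eq_of_mem_replicate hac
      omega
  have hub : WellFormed q (compress q u ++ [Cell.sym b]) :=
    wellFormed_append.2 ⟨hu, wellFormed_singleton hb, fun x _ y hy _ => by
      simp at hy; subst hy; exact id⟩
  obtain ⟨h1, h2, h3⟩ := hu.incrSymUpdates hb
  rw [decompress_compress] at h2
  rcases Nat.eq_zero_or_pos t with rfl | ht
  · have : r = compress q u ++ [Cell.sym b] := by
      rw [← compress_decompress (by omega) hr, ← compress_decompress (by omega) hub,
        h, decompress_append, decompress_compress]
      rfl
    subst this
    have : LyndonEnum.incrUpdates q (compress q u ++ [Cell.sym b]) =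
        LyndonEnum.incrSymUpdates q (compress q u ++ [Cell.sym b]) := by
      simp [LyndonEnum.incrUpdates]
    rw [this]
    exact ⟨h1, h2, by simpa using h3⟩
  · have hubt : WellFormed q (compress q u ++ [Cell.sym b] ++ [Cell.run t]) :=
      wellFormed_append.2 ⟨hub, wellFormed_singleton ht, fun x hx _ _ hxr => by
        simp at hx; subst hx; exact absurd hxr id⟩
    have : r = compress q u ++ [Cell.sym b] ++ [Cell.run t] := by
      rw [← compress_decompress (by omega) hr, ← compress_decompress (by omega) hubt,
        h, decompress_append, decompress_append, decompress_compress]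
      simp [decompress_cons, decompress_nil, Cell.word]
    subst this
    have hi : LyndonEnum.incrUpdates q (compress q u ++ [Cell.sym b] ++ [Cell.run t]) =
        Update.pop :: LyndonEnum.incrSymUpdates q (compress q u ++ [Cell.sym b]) := by
      simp [LyndonEnum.incrUpdates]
    have ha : applyAll (compress q u ++ [Cell.sym b] ++ [Cell.run t])
        (LyndonEnum.incrUpdates q (compress q u ++ [Cell.sym b] ++ [Cell.run t])) =
        applyAll (compress q u ++ [Cell.sym b])
          (LyndonEnum.incrSymUpdates q (compress q u ++ [Cell.sym b])) := by
      rw [hi, applyAll, List.foldl_cons, Update.apply, List.dropLast_concat]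
      rfl
    rw [ha, hi]
    refine ⟨h1, h2, ?_⟩
    simp only [List.length_cons, List.length_append, List.length_nil]
    omega

/-- One step replaces the compressed representation of `w` by that of `N(w)`; the number of
updates is controlled by the lengths of the arrays and the number of missing letters. -/
lemma step_compress {q n : ℕ} {w : List ℕ} (hw : IsLyndonUpTo q n w) (hne : w ≠ [q - 1]) :
    step q n (compress q w) = compress q (duvalNext q n w) ∧
    (stepUpdates q n (compress q w)).length + (compress q (duvalNext q n w)).length ≤
      2 * (n - w.length) + (compress q w).length + 1 := by
  obtain ⟨u, b, t, hb, hD, hN⟩ := hw.exists_decomp hne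
  have hr : WellFormed q (compress q w) := wellFormed_compress hw.2.2
  have hdr : decompress q (compress q w) = w := decompress_compress q w
  have hlen : wordLen (compress q w) = w.length := by rw [← length_decompress q, hdr]
  have hext := applyAll_extendUpdates n (compress q w)
  have hext_len : (extendUpdates n (compress q w)).length =
      (takeCells (n - w.length) (List.replicate n (compress q w)).flatten).length := by
    rw [extendUpdates, List.length_map, hlen]
  rw [hlen] at hext
  have hhead : ∀ y ∈ (compress q w).head?, ¬ y.IsRun := by
    intro y hy hrun
    cases y with
    | sym a => exact hrun
    | run i =>
      obtain ⟨s, hs⟩ := List.head?_eq_some_iff.1 hy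
      have hi : 0 < i := hr.1 (Cell.run i) (by rw [hs]; simp)
      refine hne (hw.1.eq_singleton hw.2.2 ?_)
      rw [← hdr, hs, decompress_cons, Cell.word, List.getD_append _ _ _ _ (by simpa using hi)]
      simp [hi]
      omega
  generalize compress q w = r at *
  have hflat := hr.flatten_replicate hhead n
  have htake := hflat.takeCells (n - w.length)
  have hE : WellFormed q (r ++ takeCells (n - w.length) (List.replicate n r).flatten) := by
    refine wellFormed_append.2 ⟨hr, htake, fun x _ y hy _ hyr => ?_⟩
    obtain ⟨z, hz, hzr⟩ := head?_takeCells hy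
    exact hhead z (head?_flatten_replicate hz) (hzr hyr)
  -- Each cell stands for at least one letter.
  have hp : (takeCells (n - w.length) (List.replicate n r).flatten).length ≤ n - w.length := by
    refine (length_le_wordLen htake.1).trans ?_
    rw [← length_decompress q, decompress_takeCells, List.length_take]
    exact min_le_left _ _
  have hdE : decompress q (r ++ takeCells (n - w.length) (List.replicate n r).flatten) =
      u ++ b :: List.replicate t (q - 1) := by
    rw [← hD, decompress_append, decompress_takeCells, decompress_flatten_replicate, hdr,
      duvalExtend_eq_append hw.1.1 hw.2.1]
  generalize takeCells (n - w.length) (List.replicate n r).flatten = s at *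
  obtain ⟨h1, h2, h3⟩ := hE.incrUpdates hb hdE
  have hstep : step q n r = applyAll (r ++ s) (LyndonEnum.incrUpdates q (r ++ s)) := by
    rw [step, stepUpdates, applyAll_append, hext]
  have hres : step q n r = compress q (duvalNext q n w) := by
    rw [hN, ← h2, ← hstep, compress_decompress (by omega) (hstep ▸ h1)]
  refine ⟨hres, ?_⟩
  -- An appended cell counts once as an update and once in the length that enters the increment
  -- balance `h3`; hence the factor 2.
  rw [← hres, hstep, stepUpdates, hext, List.length_append]
  rw [List.length_append] at h3
  omega

/-! ### Counting Lyndon words -/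

/-- The words of length `n` over `{0, …, q - 1}`. -/
def words (q n : ℕ) : Finset (List ℕ) :=
  (Finset.univ : Finset (Fin n → Fin q)).image fun f => List.ofFn fun i => (f i : ℕ)

lemma mem_words {q n : ℕ} {w : List ℕ} :
    w ∈ words q n ↔ w.length = n ∧ ∀ a ∈ w, a < q := by
  simp only [words, Finset.mem_image, Finset.mem_univ, true_and]
  constructor
  · rintro ⟨f, rfl⟩
    simp [List.mem_ofFn]
  · rintro ⟨rfl, h⟩
    exact ⟨fun i => ⟨w[i], h _ (List.getElem_mem _)⟩, List.ofFn_getElem⟩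

lemma card_words (q n : ℕ) : (words q n).card = q ^ n := by
  rw [words, Finset.card_image_of_injective]
  · simp
  · intro f g h
    have := List.ofFn_injective h
    funext i
    exact Fin.ext (congrFun this i)

open Classical in
/-- The Lyndon words of length `n` over `{0, …, q - 1}`, as a finite set. -/
noncomputable def lyndonFinset (q n : ℕ) : Finset (List ℕ) := (words q n).filter IsLyndon

lemma mem_lyndonFinset {q n : ℕ} {w : List ℕ} :
    w ∈ lyndonFinset q n ↔ w.length = n ∧ (∀ a ∈ w, a < q) ∧ IsLyndon w := by
  simp only [lyndonFinset, Finset.mem_filter, mem_words, and_assoc]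

lemma coe_lyndonFinset (q n : ℕ) : (lyndonFinset q n : Set (List ℕ)) = lyndonWords q n := by
  ext w
  exact mem_lyndonFinset

lemma card_lyndonFinset (q n : ℕ) : (lyndonFinset q n).card = ell q n := by
  rw [ell, ← coe_lyndonFinset, Set.ncard_coe_finset]

lemma rotate_mem_words {q n : ℕ} {w : List ℕ} (hw : w ∈ words q n) (i : ℕ) :
    w.rotate i ∈ words q n := by
  simpa [mem_words] using hw

/-- The rotations of the Lyndon words of length `n` are pairwise distinct. -/
lemma mul_ell_le (q n : ℕ) : n * ell q n ≤ q ^ n := by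
  rw [← card_lyndonFinset, ← card_words, ← Finset.card_range n, ← Finset.card_product,
    Finset.card_range]
  have key : ∀ u v : List ℕ, ∀ i j : ℕ, IsLyndon u → IsLyndon v → u.length = n → v.length = n →
      i ≤ j → j < n → u.rotate i = v.rotate j → i = j := by
    intro u v i j hu hv hun hvn hij hj h
    by_contra hne
    -- If `i < j`, then `u` and `v` are nontrivial rotations of each other, and each would be
    -- smaller than the other.
    have h1 : u = v.rotate (j - i) := by
      refine List.rotate_injective i ?_
      simp only [List.rotate_rotate]
      rwa [Nat.sub_add_cancel hij]
    have h2 : u.rotate (n - (j - i)) = v := by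
      rw [h1, List.rotate_rotate, show j - i + (n - (j - i)) = v.length by omega,
        List.rotate_length]
    have h3 := hv.2 (j - i) (by omega) (by omega)
    have h4 := hu.2 (n - (j - i)) (by omega) (by omega)
    rw [← h1] at h3
    rw [h2] at h4
    exact lt_asymm h3 h4
  refine Finset.card_le_card_of_injOn (fun p => p.2.rotate p.1) ?_ ?_
  · rintro ⟨i, w⟩ h
    simp only [Finset.coe_product, Set.mem_prod, Finset.mem_coe, mem_lyndonFinset] at h
    exact rotate_mem_words (mem_words.2 ⟨h.2.1, h.2.2.1⟩) i
  · rintro ⟨i, u⟩ hu ⟨j, v⟩ hv h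
    simp only [Finset.coe_product, Set.mem_prod, Finset.mem_coe, mem_lyndonFinset,
      Finset.mem_range] at hu hv
    simp only at h
    have hij : i = j := by
      rcases le_total i j with hij | hij
      · exact key u v i j hu.2.2.2 hv.2.2.2 hu.2.1 hv.2.1 hij hv.1 h
      · exact (key v u j i hv.2.2.2 hu.2.2.2 hv.2.1 hu.2.1 hij hu.1 h.symm).symm
    subst hij
    exact Prod.ext rfl (List.rotate_injective i h)

/-- A word that differs from its nontrivial rotations is a rotation of a Lyndon word. -/
lemma exists_rotate_eq {q n : ℕ} (hn : 0 < n) {w : List ℕ} (hw : w ∈ words q n)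
    (h : ∀ d, 0 < d → d < n → w.rotate d ≠ w) :
    ∃ i < n, ∃ v ∈ lyndonFinset q n, v.rotate i = w := by
  have hwl := (mem_words.1 hw).1
  -- The least rotation is Lyndon: an equality with another rotation would give a symmetry of `w`.
  obtain ⟨i, hi, hmin⟩ := (Finset.range n).exists_min_image (fun i => w.rotate i)
    ⟨0, Finset.mem_range.2 hn⟩
  rw [Finset.mem_range] at hi
  have hl : (w.rotate i).length = n := by rw [List.length_rotate, hwl]
  have hly : IsLyndon (w.rotate i) := by
    refine ⟨by rintro h; rw [h] at hl; simp at hl; omega, fun d hd hdn => ?_⟩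
    rw [hl] at hdn
    refine lt_of_le_of_ne ?_ fun heq => ?_
    · rw [List.rotate_rotate, ← List.rotate_mod w (i + d)]
      exact hmin _ (Finset.mem_range.2 (hwl ▸ Nat.mod_lt _ (by omega)))
    · rw [List.rotate_rotate, add_comm, ← List.rotate_rotate] at heq
      exact h d hd hdn (List.rotate_injective i heq).symm
  have hmem := mem_words.1 (rotate_mem_words hw i)
  -- Rotating by `n - i` undoes the rotation by `i`; the remainder keeps the index below `n` when `i
  -- = 0`.
  refine ⟨(n - i) % n, Nat.mod_lt _ hn, w.rotate i,
    mem_lyndonFinset.2 ⟨hmem.1, hmem.2, hly⟩, ?_⟩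
  nth_rewrite 2 [← hl]
  rw [List.rotate_mod, List.rotate_rotate, show i + (n - i) = w.length by omega,
    List.rotate_length]

/-- A word that is fixed by the rotation by `d` is determined by its first `d` letters. -/
lemma card_filter_rotate_eq_le {q n d : ℕ} (hd : 0 < d) (hdn : d ≤ n) :
    ((words q n).filter fun w => w.rotate d = w).card ≤ q ^ d := by
  rw [← card_words q d]
  refine Finset.card_le_card_of_injOn (fun w => w.take d) ?_ ?_
  · intro w hw
    simp only [Finset.coe_filter, Set.mem_ofPred_eq, mem_words] at hw
    refine mem_words.2 ⟨?_, fun a ha => hw.1.2 a (List.mem_of_mem_take ha)⟩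
    rw [List.length_take]
    omega
  · intro u hu v hv h
    simp only [Finset.coe_filter, Set.mem_ofPred_eq, mem_words] at hu hv
    have key : ∀ w : List ℕ, w.length = n → w.rotate d = w → ∀ i, d + i < n →
        w.getD (d + i) 0 = w.getD i 0 := by
      intro w hw hr i hi
      have := getD_rotate w d i (by omega)
      rw [hr, Nat.mod_eq_of_lt (by omega)] at this
      rw [this, add_comm]
    refine ext_getD (by omega) fun i => ?_
    induction i using Nat.strong_induction_on with
    | _ i ih =>
      intro hi
      rcases lt_or_ge i d with hid | hid
      · rw [← getD_take hid, ← getD_take (w := v) hid]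
        exact congrArg (fun l : List ℕ => l.getD i 0) h
      · obtain ⟨e, rfl⟩ := Nat.exists_eq_add_of_le hid
        rw [key u hu.1.1 hu.2 e (by omega), key v hv.1.1 hv.2 e (by omega)]
        exact ih e (by omega) (by omega)

/-- One of `d` and `n - d` is at most `n / 2`, so only short periods have to be counted. -/
lemma rotate_sub_eq {n d : ℕ} {w : List ℕ} (hw : w.length = n) (hdn : d ≤ n)
    (h : w.rotate d = w) : w.rotate (n - d) = w := by
  nth_rewrite 1 [← h]
  rw [List.rotate_rotate, show d + (n - d) = w.length by omega, List.rotate_length]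

/-- All but few words are rotations of Lyndon words. -/
lemma pow_le_mul_ell_add {q n : ℕ} (hn : 0 < n) :
    q ^ n ≤ n * ell q n + ∑ d ∈ Finset.Icc 1 (n / 2), q ^ d := by
  have hsub : words q n ⊆ (Finset.range n ×ˢ lyndonFinset q n).image (fun p => p.2.rotate p.1) ∪
      (Finset.Icc 1 (n / 2)).biUnion fun d => (words q n).filter fun w => w.rotate d = w := by
    intro w hw
    rw [Finset.mem_union, or_iff_not_imp_right]
    intro hnot
    obtain ⟨i, hi, v, hv, h⟩ := exists_rotate_eq hn hw fun d hd hdn heq => hnot <| by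
      rw [Finset.mem_biUnion]
      rcases le_or_gt d (n / 2) with h | h
      · exact ⟨d, Finset.mem_Icc.2 ⟨hd, h⟩, Finset.mem_filter.2 ⟨hw, heq⟩⟩
      · exact ⟨n - d, Finset.mem_Icc.2 ⟨by omega, by omega⟩, Finset.mem_filter.2
          ⟨hw, rotate_sub_eq (mem_words.1 hw).1 hdn.le heq⟩⟩
    exact Finset.mem_image.2 ⟨(i, v), Finset.mk_mem_product (Finset.mem_range.2 hi) hv, h⟩
  rw [← card_words]
  refine (Finset.card_le_card hsub).trans ((Finset.card_union_le _ _).trans (add_le_add ?_ ?_))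
  · refine Finset.card_image_le.trans ?_
    rw [Finset.card_product, Finset.card_range, card_lyndonFinset]
  · refine Finset.card_biUnion_le.trans (Finset.sum_le_sum fun d hd => ?_)
    rw [Finset.mem_Icc] at hd
    exact card_filter_rotate_eq_le (by omega) (by omega)

/-! ### The numbers `L_n` and `Λ_n` -/

/-- The number `ℓ_m` occurs in `L_m, …, L_n`, that is `n - m + 1` times. So `Λ_n - L_n` counts each
Lyndon word of length `m ≤ n` with its `n - m` missing letters. -/
lemma cumLambda_eq (q n : ℕ) :
    cumLambda q n = cumL q n + ∑ m ∈ Finset.Icc 1 n, ell q m * (n - m) := by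
  induction n with
  | zero => simp [cumLambda, cumL]
  | succ n ih =>
    have h1 : cumLambda q (n + 1) = cumLambda q n + cumL q (n + 1) := by
      rw [cumLambda, Finset.sum_Icc_succ_top (by omega)]
      rfl
    rw [h1, ih, Finset.sum_Icc_succ_top (by omega), Nat.sub_self, mul_zero, add_zero,
      add_comm (cumL q (n + 1)), add_left_inj, cumL, ← Finset.sum_add_distrib]
    refine Finset.sum_congr rfl fun m hm => ?_
    rw [Finset.mem_Icc] at hm
    rw [Nat.succ_sub hm.2, Nat.mul_succ, add_comm]

/-- Each word shorter than `n` has at least one missing letter. -/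
lemma cumL_le (q n : ℕ) :
    cumL q n ≤ ∑ m ∈ Finset.Icc 1 n, ell q m * (n - m) + ell q n := by
  cases n with
  | zero => simp [cumL]
  | succ n =>
    rw [cumL, Finset.sum_Icc_succ_top (by omega), Finset.sum_Icc_succ_top (by omega),
      Nat.sub_self, mul_zero, add_zero, add_le_add_iff_right]
    refine Finset.sum_le_sum fun m hm => ?_
    rw [Finset.mem_Icc] at hm
    exact Nat.le_mul_of_pos_right _ (by omega)

/-- The Lyndon words of length at most `n` over `{0, …, q - 1}`, as a finite set. -/
noncomputable def lyndonUpTo (q n : ℕ) : Finset (List ℕ) :=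
  (Finset.Icc 1 n).biUnion (lyndonFinset q)

lemma mem_lyndonUpTo {q n : ℕ} {w : List ℕ} : w ∈ lyndonUpTo q n ↔ IsLyndonUpTo q n w := by
  simp only [lyndonUpTo, Finset.mem_biUnion, mem_lyndonFinset, Finset.mem_Icc, IsLyndonUpTo]
  constructor
  · rintro ⟨m, hm, rfl, h1, h2⟩
    exact ⟨h2, hm.2, h1⟩
  · rintro ⟨h1, h2, h3⟩
    exact ⟨w.length, ⟨List.length_pos_iff.2 h1.1, h2⟩, rfl, h3, h1⟩

lemma sum_lyndonUpTo (q n : ℕ) (f : ℕ → ℕ) :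
    ∑ w ∈ lyndonUpTo q n, f w.length = ∑ m ∈ Finset.Icc 1 n, ell q m * f m := by
  rw [lyndonUpTo, Finset.sum_biUnion]
  · refine Finset.sum_congr rfl fun m _ => ?_
    rw [Finset.sum_congr rfl fun w hw => by rw [(mem_lyndonFinset.1 hw).1], Finset.sum_const,
      card_lyndonFinset, smul_eq_mul]
  · intro a _ b _ hab
    refine Finset.disjoint_left.2 fun w ha hb => hab ?_
    rw [← (mem_lyndonFinset.1 ha).1, ← (mem_lyndonFinset.1 hb).1]

lemma card_lyndonUpTo (q n : ℕ) : (lyndonUpTo q n).card = cumL q n := by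
  have := sum_lyndonUpTo q n fun _ => 1
  simpa [cumL] using this

/-! ### The run of the algorithm -/

/-- For `n ≥ 2` this is `firstWord n`, which thus inherits the Lyndon property and minimality from
Duval's successor. -/
lemma duvalNext_zero {q n : ℕ} (hq : 2 ≤ q) (hn : 0 < n) :
    duvalNext q n [0] = List.replicate (n - 1) 0 ++ [1] := by
  have h : duvalExtend n [0] = List.replicate (n - 1) 0 ++ 0 :: List.replicate 0 (q - 1) := by
    have h1 : (List.replicate n [0]).flatten = List.replicate n 0 := by
      induction n with
      | zero => simp at hn
      | succ n ih => simp [List.replicate_succ]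
    rw [duvalExtend, h1, List.take_replicate, min_self, List.replicate_zero,
      ← List.replicate_succ', Nat.sub_add_cancel hn]
  rw [duvalNext, h, duvalIncr_append (by omega)]

lemma isLyndonUpTo_zero {q n : ℕ} (hq : 0 < q) (hn : 0 < n) : IsLyndonUpTo q n [0] :=
  ⟨⟨by simp, fun i hi h => by simp at h; omega⟩, hn, by simpa using hq⟩

lemma isLyndonUpTo_firstWord {q n : ℕ} (hq : 2 ≤ q) (hn : 0 < n) :
    IsLyndonUpTo q n (firstWord n) := by
  have h0 := isLyndonUpTo_zero (q := q) (by omega) hn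
  unfold firstWord
  split_ifs with h
  · exact h0
  · rw [← duvalNext_zero hq hn]
    exact h0.next (by simp; omega)

lemma length_firstWord {n : ℕ} (hn : 0 < n) : (firstWord n).length = n := by
  unfold firstWord
  split_ifs with h
  · simp [h]
  · simp; omega

/-- The first word is the least Lyndon word of length `n`. -/
lemma firstWord_le {q n : ℕ} (hq : 2 ≤ q) {v : List ℕ} (hv : IsLyndonUpTo q n v)
    (hl : v.length = n) : firstWord n ≤ v := by
  have hn : 0 < n := hl ▸ List.length_pos_iff.2 hv.1.1
  rcases eq_or_ne v [0] with rfl | hne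
  · simp [firstWord, ← hl]
  have hlt : [0] < v := by
    rw [lt_iff_getD]
    rcases Nat.eq_zero_or_pos (v.getD 0 0) with h | h
    · refine ⟨1, ?_, le_rfl, fun j hj => ?_, fun h => by simp at h⟩
      · by_contra hcon
        refine hne (ext_getD (by simp; omega) fun i hi => ?_)
        obtain rfl : i = 0 := by omega
        simpa using h
      · obtain rfl : j = 0 := by omega
        simpa using h.symm
    · exact ⟨0, by omega, by simp, by simp, by simpa using h⟩
  unfold firstWord
  split_ifs with h
  · exact hlt.le
  · rw [← duvalNext_zero hq hn]
    exact (isLyndonUpTo_zero (by omega) hn).next_le (by simp; omega) hv hlt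

lemma zero_lt_firstWord {q n : ℕ} (hq : 2 ≤ q) (hn : 2 ≤ n) : [0] < firstWord n := by
  rw [firstWord, if_neg (by omega), ← duvalNext_zero hq (by omega)]
  exact (isLyndonUpTo_zero (by omega) (by omega)).lt_next (by simp; omega)

/-- The word reached after `k` applications of Duval's successor. -/
def visit (q n k : ℕ) : List ℕ := (duvalNext q n)^[k] (firstWord n)

lemma visit_succ (q n k : ℕ) : visit q n (k + 1) = duvalNext q n (visit q n k) :=
  Function.iterate_succ_apply' _ _ _

lemma state_succ (q n k : ℕ) : state q n (k + 1) = step q n (state q n k) :=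
  Function.iterate_succ_apply' _ _ _

/-- The restriction on `k` is needed because `duvalNext` sends `[q-1]` to the empty word. -/
lemma isLyndonUpTo_visit {q n : ℕ} (hq : 2 ≤ q) (hn : 0 < n) {k : ℕ} (hk : ∀ j < k, visit q n j ≠ [q - 1]) :
    IsLyndonUpTo q n (visit q n k) := by
  induction k with
  | zero => exact isLyndonUpTo_firstWord hq hn
  | succ k ih =>
    rw [visit_succ]
    exact (ih fun j hj => hk j (by omega)).next (hk k (by omega))

lemma visit_lt_succ {q n : ℕ} (hq : 2 ≤ q) (hn : 0 < n) {k : ℕ} (hk : ∀ j ≤ k, visit q n j ≠ [q - 1]) :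
    visit q n k < visit q n (k + 1) := by
  rw [visit_succ]
  exact (isLyndonUpTo_visit hq hn fun j hj => hk j hj.le).lt_next (hk k le_rfl)

lemma state_eq_compress {q n : ℕ} (hq : 2 ≤ q) (hn : 0 < n) {k : ℕ} (hk : ∀ j < k, visit q n j ≠ [q - 1]) :
    state q n k = compress q (visit q n k) := by
  induction k with
  | zero => rfl
  | succ k ih =>
    rw [state_succ, visit_succ, ih fun j hj => hk j (by omega),
      (step_compress (isLyndonUpTo_visit hq hn fun j hj => hk j (by omega)) (hk k (by omega))).1]

/-- Otherwise the visited words would increase strictly forever inside a finite set. -/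
lemma exists_visit_eq {q n : ℕ} (hq : 2 ≤ q) (hn : 0 < n) : ∃ k, visit q n k = [q - 1] := by
  by_contra! hcon
  have hmono : StrictMono (visit q n) :=
    strictMono_nat_of_lt_succ fun k => visit_lt_succ hq hn fun j _ => hcon j
  refine Set.infinite_of_injective_forall_mem hmono.injective (s := lyndonUpTo q n)
    (fun k => ?_) (Finset.finite_toSet _)
  exact mem_lyndonUpTo.2 (isLyndonUpTo_visit hq hn fun j _ => hcon j)

lemma halted_compress_iff {q : ℕ} (hq : 2 ≤ q) (w : List ℕ) : Halted (compress q w) ↔ w = [q - 1] := by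
  constructor
  · intro h
    rw [← decompress_compress q w, show compress q w = [Cell.run 1] from h]
    rfl
  · rintro rfl
    have : q - 1 + 1 = q := by omega
    simp [Halted, compress, this]

lemma haltTime_spec {q n : ℕ} (hq : 2 ≤ q) (hn : 0 < n) : visit q n (haltTime q n) = [q - 1] ∧
    (∀ k < haltTime q n, visit q n k ≠ [q - 1]) ∧ Halted (state q n (haltTime q n)) := by
  classical
  have hex := exists_visit_eq hq hn
  have hmin : ∀ k < Nat.find hex, visit q n k ≠ [q - 1] := fun k hk => Nat.find_min hex hk
  have hhalt : Halted (state q n (Nat.find hex)) := by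
    rw [state_eq_compress hq hn hmin, halted_compress_iff hq]
    exact Nat.find_spec hex
  have heq : haltTime q n = Nat.find hex := by
    refine le_antisymm (Nat.sInf_le hhalt) (le_csInf ⟨_, hhalt⟩ fun k hk => ?_)
    by_contra! hlt
    rw [Set.mem_ofPred_eq, state_eq_compress hq hn fun j hj => hmin j (by omega),
      halted_compress_iff hq] at hk
    exact hmin k hlt hk
  rw [heq]
  exact ⟨Nat.find_spec hex, hmin, hhalt⟩

lemma isLyndonUpTo_visit_of_le {q n : ℕ} (hq : 2 ≤ q) (hn : 0 < n) {k : ℕ} (hk : k ≤ haltTime q n) :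
    IsLyndonUpTo q n (visit q n k) :=
  isLyndonUpTo_visit hq hn fun j hj => (haltTime_spec hq hn).2.1 j (by omega)

lemma state_eq_compress_of_le {q n : ℕ} (hq : 2 ≤ q) (hn : 0 < n) {k : ℕ} (hk : k ≤ haltTime q n) :
    state q n k = compress q (visit q n k) :=
  state_eq_compress hq hn fun j hj => (haltTime_spec hq hn).2.1 j (by omega)

lemma visit_lt_visit {q n : ℕ} (hq : 2 ≤ q) (hn : 0 < n) {j k : ℕ} (hjk : j < k) (hk : k ≤ haltTime q n) :
    visit q n j < visit q n k := by
  induction k, hjk using Nat.le_induction with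
  | base => exact visit_lt_succ hq hn fun i hi => (haltTime_spec hq hn).2.1 i (by omega)
  | succ k _ ih =>
    exact (ih (by omega)).trans
      (visit_lt_succ hq hn fun i hi => (haltTime_spec hq hn).2.1 i (by omega))

lemma visit_injOn {q n : ℕ} (hq : 2 ≤ q) (hn : 0 < n) : Set.InjOn (visit q n) (Set.Iic (haltTime q n)) := by
  intro j hj k hk h
  rcases lt_trichotomy j k with hlt | heq | hlt
  · exact absurd h (visit_lt_visit hq hn hlt hk).ne
  · exact heq
  · exact absurd h (visit_lt_visit hq hn hlt hj).ne'

/-- Every Lyndon word of length at most `n` from the first word on is visited. -/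
lemma exists_visit_eq_of_le {q n : ℕ} (hq : 2 ≤ q) (hn : 0 < n) {v : List ℕ} (hv : IsLyndonUpTo q n v) (h : firstWord n ≤ v) :
    ∃ k ≤ haltTime q n, visit q n k = v := by
  obtain ⟨hend, hmin, -⟩ := haltTime_spec hq hn
  by_contra! hcon
  have hlt : ∀ k ≤ haltTime q n, visit q n k < v := by
    intro k
    induction k with
    | zero => exact fun hk => lt_of_le_of_ne h (hcon 0 hk)
    | succ k ih =>
      intro hk
      refine lt_of_le_of_ne ?_ (hcon _ hk)
      rw [visit_succ]
      exact (isLyndonUpTo_visit_of_le hq hn (by omega)).next_le (hmin k hk) hv (ih (by omega))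
  have hl := hlt _ le_rfl
  rw [hend] at hl
  -- A word above `[q-1]` would need a letter larger than `q-1`.
  obtain ⟨i, hi, -, hgt⟩ := hv.1.exceeds_periodic (by simp) hl
  have := getD_lt hv.2.2 hi
  simp [periodic, Nat.mod_one] at hgt
  rw [← List.getD_eq_getElem?_getD] at hgt
  omega

lemma output_eq {q n : ℕ} (hq : 2 ≤ q) (hn : 0 < n) : output q n = ((List.range (haltTime q n + 1)).map (visit q n)).filter
    fun w => decide (w.length = n) := by
  rw [output]
  congr 1
  refine List.map_congr_left fun k hk => ?_
  rw [List.mem_range] at hk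
  rw [state_eq_compress_of_le hq hn (by omega), decompress_compress]

lemma mem_output_iff {q n : ℕ} (hq : 2 ≤ q) (hn : 0 < n) {w : List ℕ} : w ∈ output q n ↔ w ∈ lyndonWords q n := by
  rw [output_eq hq hn, List.mem_filter, List.mem_map, decide_eq_true_iff]
  constructor
  · rintro ⟨⟨k, hk, rfl⟩, hl⟩
    rw [List.mem_range] at hk
    have := isLyndonUpTo_visit_of_le hq hn (k := k) (by omega)
    exact ⟨hl, this.2.2, this.1⟩
  · rintro ⟨hl, ha, hw⟩
    have hw' : IsLyndonUpTo q n w := ⟨hw, hl.le, ha⟩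
    obtain ⟨k, hk, h⟩ := exists_visit_eq_of_le hq hn hw' (firstWord_le hq hw' hl)
    exact ⟨⟨k, List.mem_range.2 (by omega), h⟩, hl⟩

lemma nodup_output {q n : ℕ} (hq : 2 ≤ q) (hn : 0 < n) : (output q n).Nodup := by
  rw [output_eq hq hn]
  refine List.Nodup.filter _ (List.Nodup.map_on (fun j hj k hk h => ?_) List.nodup_range)
  rw [List.mem_range] at hj hk
  exact visit_injOn hq hn (Nat.lt_succ_iff.1 hj) (Nat.lt_succ_iff.1 hk) h

lemma length_output {q n : ℕ} (hq : 2 ≤ q) (hn : 0 < n) : (output q n).length = ell q n := by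
  rw [← List.toFinset_card_of_nodup (nodup_output hq hn), ← card_lyndonFinset]
  congr 1
  ext w
  rw [List.mem_toFinset, mem_output_iff hq hn, mem_lyndonFinset]
  rfl

lemma ell_pos {q n : ℕ} (hq : 2 ≤ q) (hn : 0 < n) : 0 < ell q n := by
  rw [← card_lyndonFinset, Finset.card_pos]
  have := isLyndonUpTo_firstWord hq hn
  exact ⟨firstWord n, mem_lyndonFinset.2 ⟨length_firstWord hn, this.2.2, this.1⟩⟩

/-! ### The number of updates -/

/-- Telescoping of `step_compress` with the array length as potential: `n` bounds the initial length
and `m` collects the increments. -/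
lemma sum_updates_le {q n : ℕ} (hq : 2 ≤ q) (hn : 0 < n) {m : ℕ} (hm : m ≤ haltTime q n) :
    ∑ k ∈ Finset.range m, (stepUpdates q n (state q n k)).length + (state q n m).length ≤
      2 * ∑ k ∈ Finset.range m, (n - (visit q n k).length) + n + m := by
  induction m with
  | zero =>
    have h := isLyndonUpTo_firstWord hq hn
    have := length_le_wordLen (wellFormed_compress h.2.2).1
    rw [← length_decompress q, decompress_compress, length_firstWord hn] at this
    simpa [state] using this
  | succ m ih =>
    have h1 := ih (by omega)
    have h2 := (step_compress (isLyndonUpTo_visit_of_le hq hn (k := m) (by omega))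
      ((haltTime_spec hq hn).2.1 m (by omega))).2
    rw [← visit_succ, ← state_eq_compress_of_le hq hn hm,
      ← state_eq_compress_of_le hq hn (by omega)] at h2
    rw [Finset.sum_range_succ, Finset.sum_range_succ]
    omega

lemma image_visit_subset {q n : ℕ} (hq : 2 ≤ q) (hn : 0 < n) : (Finset.range (haltTime q n)).image (visit q n) ⊆ lyndonUpTo q n := by
  intro w hw
  obtain ⟨k, hk, rfl⟩ := Finset.mem_image.1 hw
  exact mem_lyndonUpTo.2 (isLyndonUpTo_visit_of_le hq hn (Finset.mem_range.1 hk).le)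

lemma visit_injOn_range {q n : ℕ} (hq : 2 ≤ q) (hn : 0 < n) : Set.InjOn (visit q n) (Finset.range (haltTime q n)) :=
  (visit_injOn hq hn).mono fun _ hk => (Finset.mem_range.1 hk).le

lemma haltTime_le {q n : ℕ} (hq : 2 ≤ q) (hn : 0 < n) : haltTime q n ≤ cumL q n := by
  rw [← card_lyndonUpTo, ← Finset.card_range (haltTime q n),
    ← Finset.card_image_of_injOn (visit_injOn_range hq hn)]
  exact Finset.card_le_card (image_visit_subset hq hn)

/-- For `n ≥ 2` the word `0` precedes the first word and is never visited. Its `n - 1` missing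
letters are a surplus that absorbs the initial array length. -/
lemma sum_missing_le {q n : ℕ} (hq : 2 ≤ q) (hn : 0 < n) :
    ∑ k ∈ Finset.range (haltTime q n), (n - (visit q n k).length) + (n - 1) ≤
      ∑ m ∈ Finset.Icc 1 n, ell q m * (n - m) := by
  rw [← sum_lyndonUpTo q n fun m => n - m]
  rw [← Finset.sum_image (f := fun w : List ℕ => n - w.length) (visit_injOn_range hq hn)]
  have hsub := image_visit_subset hq hn
  rcases Nat.lt_or_ge n 2 with h | h
  · rw [show n - 1 = 0 by omega, add_zero]
    exact Finset.sum_le_sum_of_subset hsub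
  have h0 : [0] ∉ (Finset.range (haltTime q n)).image (visit q n) := by
    intro hmem
    obtain ⟨k, hk, hk0⟩ := Finset.mem_image.1 hmem
    rw [Finset.mem_range] at hk
    have hlt := zero_lt_firstWord hq h
    rw [← hk0] at hlt
    rcases Nat.eq_zero_or_pos k with rfl | hpos
    · exact lt_irrefl _ hlt
    · exact lt_asymm hlt (visit_lt_visit hq hn hpos hk.le)
  rw [add_comm, show n - 1 = n - [0].length from rfl,
    ← Finset.sum_insert (f := fun w : List ℕ => n - w.length) h0]
  exact Finset.sum_le_sum_of_subset
    (Finset.insert_subset (mem_lyndonUpTo.2 (isLyndonUpTo_zero (by omega) hn)) hsub)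

/-- With `S` for the sum, the final array of length one gives `total + 1 ≤ 2(S - (n - 1)) + n +
L_n`, and `L_n ≤ S + ℓ_n`. -/
lemma totalUpdates_le {q n : ℕ} (hq : 2 ≤ q) (hn : 0 < n) :
    totalUpdates q n ≤ 3 * ∑ m ∈ Finset.Icc 1 n, ell q m * (n - m) + ell q n := by
  have h1 := sum_updates_le hq hn le_rfl
  have h2 := sum_missing_le hq hn
  have h3 := haltTime_le hq hn
  have h4 := cumL_le q n
  have h5 : (state q n (haltTime q n)).length = 1 := by
    rw [show state q n (haltTime q n) = [Cell.run 1] from (haltTime_spec hq hn).2.2]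
    rfl
  rw [totalUpdates]
  omega

lemma amortizedUpdates_le {q n : ℕ} (hq : 2 ≤ q) (hn : 0 < n) :
    amortizedUpdates q n ≤ (3 * ((cumLambda q n : ℝ) - (cumL q n : ℝ)) + (ell q n : ℝ)) /
      (ell q n : ℝ) := by
  rw [amortizedUpdates, length_output hq hn]
  refine div_le_div_of_nonneg_right ?_ (Nat.cast_nonneg _)
  have h : (totalUpdates q n : ℝ) ≤
      ((3 * ∑ m ∈ Finset.Icc 1 n, ell q m * (n - m) + ell q n : ℕ) : ℝ) :=
    Nat.cast_le.2 (totalUpdates_le hq hn)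
  rw [cumLambda_eq]
  push_cast at h ⊢
  linarith

/-! ### The asymptotic behaviour of the bound -/

open Filter Topology

lemma sum_pow_le {q : ℕ} (hq : 2 ≤ q) (h : ℕ) : ∑ d ∈ Finset.Icc 1 h, q ^ d ≤ 2 * q ^ h := by
  induction h with
  | zero => simp
  | succ h ih =>
    rw [Finset.sum_Icc_succ_top (by omega)]
    have : 2 * q ^ h ≤ q ^ (h + 1) := by
      rw [pow_succ, mul_comm]
      exact Nat.mul_le_mul_left _ hq
    omega

lemma pow_le_two_mul_ell {q n : ℕ} (hq : 2 ≤ q) (hn : 0 < n) : q ^ n ≤ 2 * (n * ell q n) := by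
  have h1 := pow_le_mul_ell_add (q := q) hn
  have h2 : 2 * ∑ d ∈ Finset.Icc 1 (n / 2), q ^ d ≤ q ^ n := by
    have hmono : ∀ {a b : ℕ}, a ≤ b → q ^ a ≤ q ^ b := fun h => Nat.pow_le_pow_right (by omega) h
    have h4 : q ^ 2 ≤ q ^ n ∨ n / 2 = 0 := by
      rcases Nat.eq_zero_or_pos (n / 2) with h | h
      · exact Or.inr h
      · exact Or.inl (hmono (by omega))
    -- For `n ≥ 4` the geometric bound suffices, as `4 q^(n/2) ≤ q^(n/2+2) ≤ q^n`; it is too weak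
    -- for `n ≤ 3`, where the sum is `0` or `q`.
    rcases Nat.lt_or_ge (n / 2) 2 with h | h
    · interval_cases hc : n / 2
      · simp
      · have : 2 * q ≤ q ^ 2 := by rw [pow_two]; exact Nat.mul_le_mul_right _ hq
        simp at h4 ⊢
        omega
    · have h3 := sum_pow_le hq (n / 2)
      have h5 : q ^ (n / 2) * 2 ^ 2 ≤ q ^ (n / 2 + 2) := by
        rw [pow_add]
        exact Nat.mul_le_mul_left _ (Nat.pow_le_pow_left hq 2)
      have h6 := hmono (show n / 2 + 2 ≤ n by omega)
      omega
  omega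

/-- Combines `(n-j) ℓ_{n-j} ≤ q^{n-j}` and `q^n ≤ 2n ℓ_n` with `n ≤ (j+1)(n-j)`. The alphabet enters
only through `2^j ≤ q^j`, so the bound is uniform in `q`. -/
lemma ell_sub_mul_le {q n j : ℕ} (hq : 2 ≤ q) (hj : j < n) :
    ell q (n - j) * 2 ^ j ≤ 2 * (j + 1) * ell q n := by
  obtain ⟨m, rfl⟩ : ∃ m, n = j + (m + 1) := ⟨n - j - 1, by omega⟩
  rw [Nat.add_sub_cancel_left]
  refine Nat.le_of_mul_le_mul_left ?_ (Nat.succ_pos m)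
  have h1 := mul_ell_le q (m + 1)
  have h2 := pow_le_two_mul_ell hq (show 0 < j + (m + 1) by omega)
  calc (m + 1) * (ell q (m + 1) * 2 ^ j) = (m + 1) * ell q (m + 1) * 2 ^ j := by ring
    _ ≤ q ^ (m + 1) * q ^ j := Nat.mul_le_mul h1 (Nat.pow_le_pow_left hq j)
    _ = q ^ (j + (m + 1)) := by ring
    _ ≤ 2 * ((j + (m + 1)) * ell q (j + (m + 1))) := h2
    _ ≤ 2 * ((j + 1) * (m + 1) * ell q (j + (m + 1))) := by
      gcongr
      nlinarith
    _ = (m + 1) * (2 * (j + 1) * ell q (j + (m + 1))) := by ring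

/-- The summands of `(Λ_n - L_n) / ℓ_n`, indexed by the number of missing letters. -/
noncomputable def ratioTerm (q n j : ℕ) : ℝ :=
  if j < n then j * (ell q (n - j) : ℝ) / ell q n else 0

lemma ratioTerm_nonneg (q n j : ℕ) : 0 ≤ ratioTerm q n j := by
  unfold ratioTerm
  split_ifs <;> positivity

lemma ratioTerm_le {q : ℕ} (hq : 2 ≤ q) (n j : ℕ) :
    ratioTerm q n j ≤ 2 * j * (j + 1) * (1 / 2) ^ j := by
  unfold ratioTerm
  split_ifs with h
  · have h0 : (0 : ℝ) < ell q n := Nat.cast_pos.2 (ell_pos hq (by omega))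
    have h1 : (ell q (n - j) : ℝ) * 2 ^ j ≤ 2 * (j + 1) * ell q n := by
      exact_mod_cast ell_sub_mul_le hq h
    rw [div_le_iff₀ h0]
    have h2 : (ell q (n - j) : ℝ) ≤ 2 * (j + 1) * ell q n * (1 / 2) ^ j := by
      rwa [one_div, inv_pow, ← div_eq_mul_inv, le_div_iff₀ (by positivity)]
    calc (j : ℝ) * ell q (n - j) ≤ j * (2 * (j + 1) * ell q n * (1 / 2) ^ j) := by gcongr
      _ = _ := by ring
  · positivity

lemma summable_majorant : Summable fun j : ℕ => 2 * (j : ℝ) * (j + 1) * (1 / 2) ^ j := by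
  have h : ‖(1 / 2 : ℝ)‖ < 1 := by norm_num
  have h2 := (summable_pow_mul_geometric_of_norm_lt_one 2 h).mul_left 2
  have h1 := (summable_pow_mul_geometric_of_norm_lt_one 1 h).mul_left 2
  refine (h2.add h1).congr fun j => ?_
  ring

lemma tsum_ratioTerm (q n : ℕ) :
    ∑' j, ratioTerm q n j = ((cumLambda q n : ℝ) - cumL q n) / ell q n := by
  rw [tsum_eq_sum (s := Finset.range n) fun j hj => by
    rw [Finset.mem_range] at hj
    exact if_neg hj]
  rw [cumLambda_eq]
  push_cast
  rw [add_sub_cancel_left, Finset.sum_div]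
  refine Finset.sum_nbij' (fun j => n - j) (fun m => n - m) ?_ ?_ ?_ ?_ ?_
  · intro j hj
    rw [Finset.mem_range] at hj
    exact Finset.mem_Icc.2 ⟨by omega, by omega⟩
  · intro m hm
    rw [Finset.mem_Icc] at hm
    exact Finset.mem_range.2 (by omega)
  · intro j hj
    rw [Finset.mem_range] at hj
    omega
  · intro m hm
    rw [Finset.mem_Icc] at hm
    omega
  · intro j hj
    rw [Finset.mem_range] at hj
    rw [ratioTerm, if_pos hj, Nat.sub_sub_self hj.le, mul_comm]

lemma summable_ratioTerm {q : ℕ} (hq : 2 ≤ q) (n : ℕ) : Summable (ratioTerm q n) :=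
  summable_majorant.of_nonneg_of_le (ratioTerm_nonneg q n) (ratioTerm_le hq n)

/-! ### The limit series and the uniform density of rotations of Lyndon words -/

lemma norm_inv_lt_one {q : ℕ} (hq : 2 ≤ q) : ‖(q : ℝ)⁻¹‖ < 1 := by
  rw [Real.norm_of_nonneg (by positivity)]
  exact inv_lt_one_of_one_lt₀ (by exact_mod_cast hq)

lemma tsum_mul_inv_pow {q : ℕ} (hq : 2 ≤ q) :
    ∑' j : ℕ, (j : ℝ) * (q : ℝ)⁻¹ ^ j = q / ((q : ℝ) - 1) ^ 2 := by
  have h2 : (2 : ℝ) ≤ q := by exact_mod_cast hq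
  have h3 : (q : ℝ) - 1 ≠ 0 := by linarith
  rw [tsum_coe_mul_geometric_of_norm_lt_one (norm_inv_lt_one hq)]
  field_simp

/-- The proportion of the words of length `n` that are rotations of Lyndon words. -/
noncomputable def lyndonDensity (q n : ℕ) : ℝ := n * ell q n / (q : ℝ) ^ n

/-- At most `2 q^(n/2)` words are not rotations of Lyndon words; their proportion is largest for `q
= 2` in this estimate, which removes `q`. -/
lemma abs_lyndonDensity_sub_one_le {q n : ℕ} (hq : 2 ≤ q) (hn : 0 < n) :
    |lyndonDensity q n - 1| ≤ 2 * (1 / 2) ^ (n - n / 2) := by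
  have hq0 : (0 : ℝ) < q := by positivity
  have h1 : (n : ℝ) * ell q n ≤ (q : ℝ) ^ n := by exact_mod_cast mul_ell_le q n
  have h2 : (q : ℝ) ^ n ≤ n * ell q n + 2 * (q : ℝ) ^ (n / 2) := by
    exact_mod_cast (pow_le_mul_ell_add hn).trans (Nat.add_le_add_left (sum_pow_le hq (n / 2)) _)
  have h3 : lyndonDensity q n ≤ 1 := (div_le_one (by positivity)).2 h1
  have h4 : (q : ℝ) ^ n = q ^ (n / 2) * q ^ (n - n / 2) := by
    rw [← pow_add]
    congr 1
    omega
  have h5 : (q : ℝ) ^ (n / 2) / q ^ n ≤ (1 / 2) ^ (n - n / 2) := by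
    rw [h4, div_mul_cancel_left₀ (by positivity), one_div, inv_pow]
    refine inv_anti₀ (by positivity) (pow_le_pow_left₀ (by norm_num) (by exact_mod_cast hq) _)
  have h6 : 1 ≤ lyndonDensity q n + 2 * ((q : ℝ) ^ (n / 2) / q ^ n) := by
    rw [lyndonDensity, ← mul_div_assoc, ← add_div, one_le_div (by positivity)]
    exact h2
  rw [abs_le]
  constructor <;> linarith

/-- Pairs of a length tending to infinity and an arbitrary alphabet size `q ≥ 2`. -/
def lengthFilter : Filter (ℕ × ℕ) := atTop ×ˢ 𝓟 {q | 2 ≤ q}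

lemma eventually_lengthFilter (N : ℕ) : ∀ᶠ p : ℕ × ℕ in lengthFilter, N ≤ p.1 ∧ 2 ≤ p.2 :=
  eventually_prod_principal_iff.2 ((eventually_ge_atTop N).mono fun _ hn _ hq => ⟨hn, hq⟩)

lemma tendsto_fst_lengthFilter : Tendsto Prod.fst lengthFilter atTop := tendsto_fst

lemma tendsto_lyndonDensity (j : ℕ) :
    Tendsto (fun p : ℕ × ℕ => lyndonDensity p.2 (p.1 - j)) lengthFilter (𝓝 1) := by
  have h0 : Tendsto (fun n : ℕ => n - n / 2) atTop atTop :=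
    tendsto_atTop_mono (f := fun n : ℕ => n / 2) (fun n => by omega)
      (Nat.tendsto_div_const_atTop (by norm_num))
  have h1 : Tendsto (fun n : ℕ => 2 * (1 / 2 : ℝ) ^ (n - n / 2)) atTop (𝓝 0) := by
    simpa using ((tendsto_pow_atTop_nhds_zero_of_lt_one (r := (1 / 2 : ℝ)) (by norm_num)
      (by norm_num)).comp h0).const_mul 2
  have h2 := (h1.comp (tendsto_sub_atTop_nat j)).comp tendsto_fst_lengthFilter
  rw [tendsto_iff_norm_sub_tendsto_zero]
  refine squeeze_zero' (Eventually.of_forall fun _ => norm_nonneg _) ?_ h2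
  filter_upwards [eventually_lengthFilter (j + 1)] with p hp
  exact abs_lyndonDensity_sub_one_le hp.2 (by omega)

/-- Writing `ℓ_m` as `q^m / m` times the density isolates a relative error that tends to zero
uniformly in `q`. -/
lemma ratioTerm_sub_eq {q n j : ℕ} (hq : 2 ≤ q) (hj : j < n) :
    ratioTerm q n j - j * (q : ℝ)⁻¹ ^ j = j * (q : ℝ)⁻¹ ^ j *
      ((n : ℝ) / (n - j) * lyndonDensity q (n - j) / lyndonDensity q n - 1) := by
  have h0 : (ell q n : ℝ) ≠ 0 := Nat.cast_ne_zero.2 (ell_pos hq (by omega)).ne'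
  have hq0 : (q : ℝ) ≠ 0 := by positivity
  obtain ⟨m, rfl⟩ := Nat.exists_eq_add_of_lt hj
  rw [ratioTerm, if_pos hj, lyndonDensity, lyndonDensity,
    show j + m + 1 - j = m + 1 by omega] at *
  push_cast
  have h1 : (j : ℝ) + m + 1 ≠ 0 := by positivity
  have h2 : (m : ℝ) + 1 ≠ 0 := by positivity
  have h3 : (j : ℝ) + m + 1 - j = m + 1 := by ring
  rw [h3, inv_pow]
  field_simp
  ring

lemma tendsto_ratioTerm_sub (j : ℕ) :
    Tendsto (fun p : ℕ × ℕ => ratioTerm p.2 p.1 j - j * (p.2 : ℝ)⁻¹ ^ j) lengthFilter (𝓝 0) := by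
  have h1 : Tendsto (fun n : ℕ => (n : ℝ) / (n - j)) atTop (𝓝 1) := by
    simpa [sub_eq_add_neg] using tendsto_natCast_div_add_atTop (-(j : ℝ))
  have h2 := ((h1.comp tendsto_fst_lengthFilter).mul (tendsto_lyndonDensity j)).div
    (tendsto_lyndonDensity 0) one_ne_zero
  have h3 : Tendsto (fun p : ℕ × ℕ => (j : ℝ) * |(p.1 : ℝ) / (p.1 - j) *
      lyndonDensity p.2 (p.1 - j) / lyndonDensity p.2 p.1 - 1|) lengthFilter (𝓝 0) := by
    simpa using ((h2.sub_const 1).abs).const_mul (j : ℝ)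
  refine squeeze_zero_norm' ?_ h3
  filter_upwards [eventually_lengthFilter (j + 1)] with p hp
  rw [ratioTerm_sub_eq hp.2 (by omega), norm_mul, Real.norm_eq_abs (_ - 1)]
  refine mul_le_mul_of_nonneg_right ?_ (abs_nonneg _)
  rw [Real.norm_of_nonneg (by positivity)]
  refine mul_le_of_le_one_right (by positivity) (pow_le_one₀ (by positivity) ?_)
  exact inv_le_one_of_one_le₀ (by exact_mod_cast (by omega : 1 ≤ p.2))

lemma tendsto_ratio : Tendsto (fun p : ℕ × ℕ =>
    ((cumLambda p.2 p.1 : ℝ) - cumL p.2 p.1) / ell p.2 p.1 - p.2 / ((p.2 : ℝ) - 1) ^ 2)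
    lengthFilter (𝓝 0) := by
  -- The majorant is doubled because it bounds both `ratioTerm` and its limit `j q^{-j}`; the factor
  -- is not optimized.
  have hmaj : Summable fun j : ℕ => 2 * (2 * (j : ℝ) * (j + 1) * (1 / 2) ^ j) :=
    summable_majorant.mul_left 2
  have h := tendsto_tsum_of_dominated_convergence (𝓕 := lengthFilter) hmaj tendsto_ratioTerm_sub ?_
  · rw [tsum_zero] at h
    refine h.congr' ?_
    filter_upwards [eventually_lengthFilter 0] with p hp
    rw [(summable_ratioTerm hp.2 p.1).tsum_sub, tsum_ratioTerm, tsum_mul_inv_pow hp.2]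
    simpa using summable_pow_mul_geometric_of_norm_lt_one 1 (norm_inv_lt_one hp.2)
  · filter_upwards [eventually_lengthFilter 0] with p hp j
    have h1 := ratioTerm_le hp.2 p.1 j
    have h2 := ratioTerm_nonneg p.2 p.1 j
    have h3 : (0 : ℝ) ≤ j * (p.2 : ℝ)⁻¹ ^ j := by positivity
    have h4 : (j : ℝ) * (p.2 : ℝ)⁻¹ ^ j ≤ 2 * j * (j + 1) * (1 / 2) ^ j := by
      have : (p.2 : ℝ)⁻¹ ≤ 1 / 2 := by
        rw [one_div]
        exact inv_anti₀ (by norm_num) (by exact_mod_cast hp.2)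
      gcongr
      nlinarith [(Nat.cast_nonneg j : (0 : ℝ) ≤ j)]
    rw [Real.norm_eq_abs, abs_le]
    constructor <;> linarith

lemma bound_eq {q n : ℕ} (hq : 2 ≤ q) (hn : 0 < n) :
    (3 * ((cumLambda q n : ℝ) - (cumL q n : ℝ)) + (ell q n : ℝ)) / (ell q n : ℝ) =
      1 + 3 * (((cumLambda q n : ℝ) - cumL q n) / ell q n) := by
  have h0 : (ell q n : ℝ) ≠ 0 := Nat.cast_ne_zero.2 (ell_pos hq hn).ne'
  field_simp
  ring

end LyndonEnum

theorem mainTheorem4 :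
    -- the algorithm stops, keeps the compressed representation of Duval's sequence of words,
    -- lists every Lyndon word of length `n` exactly once, and satisfies the amortized bound
    (∀ q n : ℕ, 2 ≤ q → 1 ≤ n →
      (∃ k : ℕ, LyndonEnum.Halted (LyndonEnum.state q n k)) ∧
      (∀ k : ℕ, k ≤ LyndonEnum.haltTime q n →
        LyndonEnum.state q n k =
          LyndonEnum.compress q ((LyndonEnum.duvalNext q n)^[k] (LyndonEnum.firstWord n))) ∧
      (∀ w : List ℕ, w ∈ LyndonEnum.output q n ↔ w ∈ LyndonEnum.lyndonWords q n) ∧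
      (LyndonEnum.output q n).Nodup ∧
      LyndonEnum.amortizedUpdates q n ≤
        (3 * ((LyndonEnum.cumLambda q n : ℝ) - (LyndonEnum.cumL q n : ℝ))
            + (LyndonEnum.ell q n : ℝ)) / (LyndonEnum.ell q n : ℝ)) ∧
    -- the bound is `1 + 3q/(q-1)^2 + o(1)` as `n → ∞`, uniformly in `q`
    (∀ ε : ℝ, 0 < ε → ∃ N : ℕ, ∀ n : ℕ, N ≤ n → ∀ q : ℕ, 2 ≤ q →
      |(3 * ((LyndonEnum.cumLambda q n : ℝ) - (LyndonEnum.cumL q n : ℝ))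
            + (LyndonEnum.ell q n : ℝ)) / (LyndonEnum.ell q n : ℝ)
          - (1 + 3 * (q : ℝ) / ((q : ℝ) - 1) ^ 2)| < ε) ∧
    -- constant amortized time
    (∃ C : ℝ, ∀ q n : ℕ, 2 ≤ q → 1 ≤ n → LyndonEnum.amortizedUpdates q n ≤ C) := by
  refine ⟨fun q n hq hn => ⟨⟨_, (LyndonEnum.haltTime_spec hq hn).2.2⟩,
    fun k hk => LyndonEnum.state_eq_compress_of_le hq hn hk,
    fun w => LyndonEnum.mem_output_iff hq hn, LyndonEnum.nodup_output hq hn,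
    LyndonEnum.amortizedUpdates_le hq hn⟩, fun ε hε => ?_, ?_⟩
  -- The bound is `1 + 3S/ℓ_n`, so the ratio is needed to within `ε/3`.
  · have h := LyndonEnum.tendsto_ratio.eventually (Metric.ball_mem_nhds 0 (div_pos hε three_pos))
    rw [LyndonEnum.lengthFilter] at h
    obtain ⟨N, hN⟩ := Filter.eventually_atTop.1 (Filter.eventually_prod_principal_iff.1 h)
    refine ⟨max N 1, fun n hn q hq => ?_⟩
    have hd := hN n (le_of_max_le_left hn) q hq
    rw [Real.dist_0_eq_abs] at hd
    rw [LyndonEnum.bound_eq hq (le_of_max_le_right hn), add_sub_add_left_eq_sub, mul_div_assoc,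
      ← mul_sub, abs_mul, abs_of_pos three_pos]
    linarith
  -- Summing the majorant of `ratioTerm_le` bounds `S/ℓ_n` for every `n ≥ 1` and `q ≥ 2` at once,
  -- without using the limit.
  · refine ⟨1 + 3 * ∑' j : ℕ, 2 * (j : ℝ) * (j + 1) * (1 / 2) ^ j, fun q n hq hn => ?_⟩
    refine (LyndonEnum.amortizedUpdates_le hq hn).trans ?_
    rw [LyndonEnum.bound_eq hq hn, ← LyndonEnum.tsum_ratioTerm]
    have := (LyndonEnum.summable_ratioTerm hq n).tsum_le_tsum (LyndonEnum.ratioTerm_le hq n)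
      LyndonEnum.summable_majorant
    linarith
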